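/- Let $\mathrm{St}_3(\mathbb Z)$ be the group with generators $x_{ij}$ ($i,j\in\{1,2,3\}$, $i\neq j$) and relations $[x_{ij},x_{jk}]=x_{ik}$ for $i\neq k$ and $[x_{ij},x_{kl}]=1$ for $i\neq l$, $j\neq k$. For a group $\Gamma$ with a finite generating set $S$ and a unitary representation $\pi$ of $\Gamma$ on a complex Hilbert space $\mathcal H$, put $$\kappa(\Gamma,S,\pi)=\inf_{\xi\in\mathcal H,\ \|\xi\|=1}\ \max_{s\in S}\|\pi(s)\xi-\xi\|,$$ $$\kappa(\Gamma,S)=\inf\{\kappa(\Gamma,S,\pi)\mid \pi\text{ has no non-zero invariant vector}\}$$ (an infimum over the empty set is $+\infty$). $\Gamma$ is a Kazhdan group (has property (T)) if $\kappa(\Gamma,S)>0$ for some finite generating set $S$. On the real group ring $\mathbb R[\Gamma]$ let $\left(\sum_g r_g g\right)^*=\sum_g r_g g^{-1}$, and for a finite symmetric generating set $S$ let $\Delta=|S|-\sum_{s\in S}s$. Let $S=\{x_{ij}^{\pm1}\}\subset \mathrm{St}_3(\mathbb Z)$ be the symmetric generating set given by the generators, and let $\Delta\in\mathbb R[\mathrm{St}_3(\mathbb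 Z)]$ be its Laplacian. Then there exist $\varepsilon>0$ and finitely many $b_1,\dots,b_n\in\mathbb R[\mathrm{St}_3(\mathbb Z)]$ such that $$\Delta^2-\varepsilon\Delta=\sum_{i=1}^n b_i^*b_i \qquad\text{and}\qquad 0.171028\le\sqrt{\frac{2\varepsilon}{|S|}}\le\kappa(\mathrm{St}_3(\mathbb Z),S).$$ Moreover $$0.171028\le\kappa(\mathrm{St}_3(\mathbb Z),\{x_{ij}\}),$$ and $\mathrm{St}_3(\mathbb Z)$ is a Kazhdan group. -/

import Mathlib

open scoped ENNReal commutatorElement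

universe u

noncomputable section

section Kazhdan

/-- `κ(Γ, S, π) = inf_{‖ξ‖ = 1} max_{s ∈ S} ‖π(s) ξ - ξ‖`, with values in `[0, ∞]`
(the infimum over the empty set, for `H = 0`, is `∞`). -/
def kazhdanConstantRep {Γ : Type*} [Group Γ] (S : Finset Γ)
    {H : Type u} [NormedAddCommGroup H] [InnerProductSpace ℂ H]
    (π : Γ →* (H ≃ₗᵢ[ℂ] H)) : ℝ≥0∞ :=
  ⨅ (ξ : H) (_ : ‖ξ‖ = 1), ⨆ s ∈ S, ENNReal.ofReal ‖π s ξ - ξ‖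

/-- `π` has no non-zero invariant vector. -/
def HasNoInvariantVector {Γ : Type*} [Group Γ]
    {H : Type u} [NormedAddCommGroup H] [InnerProductSpace ℂ H]
    (π : Γ →* (H ≃ₗᵢ[ℂ] H)) : Prop :=
  ∀ ξ : H, (∀ g : Γ, π g ξ = ξ) → ξ = 0

/-- The (optimal) Kazhdan constant `κ(Γ, S)`: the infimum of `κ(Γ, S, π)` over all unitary
representations `π` of `Γ` on complex Hilbert spaces without non-zero invariant vectors. -/
def kazhdanConstant {Γ : Type*} [Group Γ] (S : Finset Γ) : ℝ≥0∞ :=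
  sInf {c : ℝ≥0∞ | ∃ (H : Type u) (_ : NormedAddCommGroup H) (_ : InnerProductSpace ℂ H)
    (_ : CompleteSpace H) (π : Γ →* (H ≃ₗᵢ[ℂ] H)),
    HasNoInvariantVector π ∧ c = kazhdanConstantRep S π}

/-- `Γ` is a Kazhdan group (has property (T)): it has a finite generating set `S` with
`κ(Γ, S) > 0`. -/
def IsKazhdanGroup (Γ : Type*) [Group Γ] : Prop :=
  ∃ S : Finset Γ, Subgroup.closure (S : Set Γ) = ⊤ ∧ 0 < kazhdanConstant.{u} S

end Kazhdan

section GroupRing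

/-- The `*`-operation on the real group ring: `(∑ r_g g)^* = ∑ r_g g⁻¹`. -/
def groupRingStar {Γ : Type*} [Group Γ] (b : MonoidAlgebra ℝ Γ) : MonoidAlgebra ℝ Γ :=
  MonoidAlgebra.mapDomain (fun g : Γ => g⁻¹) b

/-- The unnormalized Laplacian `Δ = |S| - ∑_{s ∈ S} s` in the real group ring. -/
def groupLaplacian {Γ : Type*} [Group Γ] (S : Finset Γ) : MonoidAlgebra ℝ Γ :=
  (S.card : ℝ) • (1 : MonoidAlgebra ℝ Γ) - ∑ s ∈ S, MonoidAlgebra.of ℝ Γ s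

/-- `a` is a sum of hermitian squares: `a = ∑ i, b_i^* b_i` for some `b_1, …, b_n` in the real
group ring. -/
def IsSumOfHermitianSquares {Γ : Type*} [Group Γ] (a : MonoidAlgebra ℝ Γ) : Prop :=
  ∃ (n : ℕ) (b : Fin n → MonoidAlgebra ℝ Γ), a = ∑ i, groupRingStar (b i) * b i

end GroupRing

section Steinberg

/-- The index set of the generators `x_ij`, `i ≠ j`. -/
abbrev SteinbergIndex (n : ℕ) : Type := {p : Fin n × Fin n // p.1 ≠ p.2}

/-- The generator `x_ij` in the free group. -/
def steinbergFreeGen {n : ℕ} (i j : Fin n) (h : i ≠ j) : FreeGroup (SteinbergIndex n) :=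
  FreeGroup.of ⟨(i, j), h⟩

/-- The Steinberg relators: `[x_ij, x_jk] = x_ik` for `i ≠ k`, and `[x_ij, x_kl] = 1` for
`i ≠ l`, `j ≠ k`. -/
def steinbergRelators (n : ℕ) : Set (FreeGroup (SteinbergIndex n)) :=
  {r | ∃ (i j k : Fin n) (hij : i ≠ j) (hjk : j ≠ k) (hik : i ≠ k),
      r = ⁅steinbergFreeGen i j hij, steinbergFreeGen j k hjk⁆ * (steinbergFreeGen i k hik)⁻¹} ∪
  {r | ∃ (i j k l : Fin n) (hij : i ≠ j) (hkl : k ≠ l), i ≠ l ∧ j ≠ k ∧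
      r = ⁅steinbergFreeGen i j hij, steinbergFreeGen k l hkl⁆}

/-- The Steinberg group `St_n(ℤ)`, by its finite presentation. -/
abbrev SteinbergGroup (n : ℕ) : Type := PresentedGroup (steinbergRelators n)

/-- The generator `x_ij` of `St_n(ℤ)`. -/
def steinbergGen {n : ℕ} (p : SteinbergIndex n) : SteinbergGroup n :=
  PresentedGroup.of p

open Classical in
/-- The generating set `{x_ij}` of `St_n(ℤ)`. -/
def steinbergGenSet (n : ℕ) : Finset (SteinbergGroup n) :=
  Finset.univ.image steinbergGen

open Classical in
/-- The symmetric generating set `{x_ij, x_ij⁻¹}` of `St_n(ℤ)`. -/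
def steinbergSymmGenSet (n : ℕ) : Finset (SteinbergGroup n) :=
  steinbergGenSet n ∪ (steinbergGenSet n).image (fun g => g⁻¹)

end Steinberg

end

/-!
Let `Δ` be the Laplacian of `S = {x_ij^{±1}}` and `ε = 22 / 125`, so that
`√(2 ε / 12) = 0.1712… > 0.171028`. The heart of the matter is an explicit decomposition of
`Δ² - ε Δ` into hermitian squares in `ℝ[St_3(ℤ)]`.

From such a decomposition the Kazhdan constant is bounded as follows. In a unitary representation
`Δ` acts as a positive operator `A` with `‖A ξ‖² ≥ ε ⟪A ξ, ξ⟫`, and its kernel consists of the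
invariant vectors. Without invariant vectors the range of `√A` is dense, and the inequality says
`⟪A η, η⟫ ≥ ε ‖η‖²` on that range, hence everywhere
(`ContinuousLinearMap.IsPositive.gap_of_injective`). As `2 ⟪A ξ, ξ⟫ = ∑ ‖π(s) ξ - ξ‖²`, some `s`
moves a unit vector by at least `√(2 ε / |S|)`
(`le_kazhdanConstant_of_isSumOfHermitianSquares`).

The decomposition is found numerically and verified exactly, after exploiting symmetry. Signed
permutation matrices and the inverse transpose induce a finite group of automorphisms of `St_3(ℤ)`
preserving `S`. Since `Δ² - ε Δ` is fixed by these and by `*`, it suffices to work with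
symmetrizations (`symmSum`), for which two elements in the same orbit are identified. For a character
`χ` of the group of order `8` generated by two sign changes and the inverse transpose, let `P_χ`
be eight times the projection to the `χ`-eigenspace. Then `a^* P_χ a` symmetrizes to a sum of squares
(`isSumOfHermitianSquares_symmSum_star_mul_twist`), because `P_χ` is self-adjoint for the form
`(a, b) ↦ symmSum (a^* b)` and `P_χ² = 8 P_χ`. The squares used are supported on products of at
most two generators.

Rounding the numerical solution leaves a residual. It need not be zero: if all its class coefficients
except that of `1` are nonpositive and they sum to zero, it is a nonnegative combination of the
symmetrizations of `1 - g`, each of which is half that of `(1 - g)^* (1 - g)`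
(`isSumOfHermitianSquares_symmSum_one_sub`). The numerical solution is chosen with enough slack
for this, so that the verification reduces to two finite computations: each word in the expansion is
taken to its class representative by a symmetry and the Steinberg relations
(`checkClass_certificateTerms`), and the class coefficients have the right signs
(`checkCoeffs_certificateTerms`). Only equalities between words matter here, so no solution of the
word problem for `St_3(ℤ)` is required.
-/

/-! ### The star operation of the real group ring -/

section Star

variable {Γ : Type*} [Group Γ]

theorem groupRingStar_add (a b : MonoidAlgebra ℝ Γ) :
    groupRingStar (a + b) = groupRingStar a + groupRingStar b :=
  MonoidAlgebra.mapDomain_add _ _ _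

theorem groupRingStar_smul (r : ℝ) (a : MonoidAlgebra ℝ Γ) :
    groupRingStar (r • a) = r • groupRingStar a := by
  simp [groupRingStar, MonoidAlgebra.mapDomain_smul]

theorem groupRingStar_of (g : Γ) :
    groupRingStar (MonoidAlgebra.of ℝ Γ g) = MonoidAlgebra.of ℝ Γ g⁻¹ := by
  simp [groupRingStar]

/-- The `*`-operation of the real group ring as a linear map. -/
noncomputable def groupRingStarLinear : MonoidAlgebra ℝ Γ →ₗ[ℝ] MonoidAlgebra ℝ Γ where
  toFun := groupRingStar
  map_add' := groupRingStar_add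
  map_smul' := groupRingStar_smul

theorem groupRingStar_sum {ι : Type*} (s : Finset ι) (f : ι → MonoidAlgebra ℝ Γ) :
    groupRingStar (∑ i ∈ s, f i) = ∑ i ∈ s, groupRingStar (f i) :=
  map_sum groupRingStarLinear f s

theorem groupRingStar_star (a : MonoidAlgebra ℝ Γ) : groupRingStar (groupRingStar a) = a := by
  induction a using MonoidAlgebra.induction_on with
  | of g => rw [groupRingStar_of, groupRingStar_of, inv_inv]
  | add a b ha hb => rw [groupRingStar_add, groupRingStar_add, ha, hb]
  | smul r a ha => rw [groupRingStar_smul, groupRingStar_smul, ha]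

theorem groupRingStar_mul (a b : MonoidAlgebra ℝ Γ) :
    groupRingStar (a * b) = groupRingStar b * groupRingStar a := by
  induction a using MonoidAlgebra.induction_on with
  | of g =>
    induction b using MonoidAlgebra.induction_on with
    | of h => simp only [← map_mul, groupRingStar_of, mul_inv_rev]
    | add a b ha hb => rw [mul_add, groupRingStar_add, groupRingStar_add, ha, hb, add_mul]
    | smul r a ha => rw [mul_smul_comm, groupRingStar_smul, groupRingStar_smul, ha, smul_mul_assoc]
  | add a b ha hb => rw [add_mul, groupRingStar_add, groupRingStar_add, ha, hb, mul_add]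
  | smul r a ha => rw [smul_mul_assoc, groupRingStar_smul, groupRingStar_smul, ha, mul_smul_comm]

end Star

/-! ### Spectral gaps of positive operators -/

section SpectralGap

open scoped InnerProductSpace

variable {H : Type*} [NormedAddCommGroup H] [InnerProductSpace ℂ H] [CompleteSpace H]

/-- On the dense range of `√A` the hypothesis `‖A ξ‖² ≥ ε ⟪A ξ, ξ⟫` reads `⟪A η, η⟫ ≥ ε ‖η‖²`. -/
theorem ContinuousLinearMap.IsPositive.gap_of_injective {A : H →L[ℂ] H} (hA : A.IsPositive)
    (hinj : ∀ ξ, A ξ = 0 → ξ = 0) {ε : ℝ}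
    (hgap : ∀ ξ, ε * (⟪A ξ, ξ⟫_ℂ).re ≤ ‖A ξ‖ ^ 2) (η : H) :
    ε * ‖η‖ ^ 2 ≤ (⟪A η, η⟫_ℂ).re := by
  have hA0 : 0 ≤ A := (ContinuousLinearMap.nonneg_iff_isPositive A).2 hA
  set B := CFC.sqrt A with hB
  have hBB : B * B = A := CFC.sqrt_mul_sqrt_self A hA0
  have hBpos : B.IsPositive :=
    (ContinuousLinearMap.nonneg_iff_isPositive B).1 (CFC.sqrt_nonneg A)
  have hAB : ∀ ξ, A ξ = B (B ξ) := fun ξ => by rw [← hBB]; rfl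
  have hinner : ∀ ξ, (⟪A ξ, ξ⟫_ℂ).re = ‖B ξ‖ ^ 2 := fun ξ => by
    rw [hAB, hBpos.inner_left_eq_inner_right, ← inner_self_eq_norm_sq (𝕜 := ℂ)]; rfl
  have hdense : Dense (Set.range B) := by
    have h : (LinearMap.range B.toLinearMap)ᗮ = ⊥ := by
      rw [ContinuousLinearMap.orthogonal_range,
        ← ContinuousLinearMap.star_eq_adjoint, hBpos.isSelfAdjoint.star_eq, eq_bot_iff]
      intro ξ hξ
      have h0 : B ξ = 0 := hξ
      exact hinj ξ (by rw [hAB, h0, map_zero])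
    have h2 := (Submodule.topologicalClosure_eq_top_iff).2 h
    rw [← Submodule.dense_iff_topologicalClosure_eq_top] at h2
    simpa [LinearMap.coe_range] using h2
  rw [hinner]
  refine hdense.induction (P := fun η => ε * ‖η‖ ^ 2 ≤ ‖B η‖ ^ 2) ?_ ?_ η
  · rintro _ ⟨ξ, rfl⟩
    rw [← hinner, ← hAB]
    exact hgap ξ
  · exact isClosed_le (by fun_prop) (by fun_prop)

end SpectralGap

/-! ### The Laplacian in unitary representations -/

section Representation

open scoped InnerProductSpace

variable {Γ : Type*} [Group Γ]
  {H : Type*} [NormedAddCommGroup H] [InnerProductSpace ℂ H]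

/-- The extension of a unitary representation of `Γ` to the real group ring. -/
noncomputable def groupRingRep (π : Γ →* (H ≃ₗᵢ[ℂ] H)) : MonoidAlgebra ℝ Γ →ₐ[ℝ] (H →L[ℂ] H) :=
  MonoidAlgebra.lift ℝ (H →L[ℂ] H) Γ
    { toFun := fun g => (π g).toContinuousLinearEquiv.toContinuousLinearMap
      map_one' := by ext; simp
      map_mul' := fun g h => by ext; simp }

theorem groupRingRep_of (π : Γ →* (H ≃ₗᵢ[ℂ] H)) (g : Γ) (ξ : H) :
    groupRingRep π (MonoidAlgebra.of ℝ Γ g) ξ = π g ξ := by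
  simp [groupRingRep]

theorem groupRingRep_laplacian (π : Γ →* (H ≃ₗᵢ[ℂ] H)) (S : Finset Γ) (ξ : H) :
    groupRingRep π (groupLaplacian S) ξ = ∑ s ∈ S, (ξ - π s ξ) := by
  rw [groupLaplacian, map_sub, map_sum, map_smul, map_one, Finset.sum_sub_distrib]
  simp only [sub_apply, sum_apply, groupRingRep_of]
  simp [Nat.cast_smul_eq_nsmul]

theorem unitaryRep_mul_apply (π : Γ →* (H ≃ₗᵢ[ℂ] H)) (g h : Γ) (ξ : H) :
    π (g * h) ξ = π g (π h ξ) := by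
  rw [map_mul]; rfl

theorem inner_unitary_left (π : Γ →* (H ≃ₗᵢ[ℂ] H)) (g : Γ) (ξ η : H) :
    ⟪π g ξ, η⟫_ℂ = ⟪ξ, π g⁻¹ η⟫_ℂ := by
  have h : η = π g (π g⁻¹ η) := by
    rw [← unitaryRep_mul_apply]; simp
  conv_lhs => rw [h]
  exact (π g).inner_map_map ξ _

theorem inner_groupRingRep_star (π : Γ →* (H ≃ₗᵢ[ℂ] H)) (b : MonoidAlgebra ℝ Γ) (ξ η : H) :
    ⟪groupRingRep π (groupRingStar b) ξ, η⟫_ℂ = ⟪ξ, groupRingRep π b η⟫_ℂ := by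
  induction b using MonoidAlgebra.induction_on with
  | of g =>
    rw [groupRingStar_of, groupRingRep_of, groupRingRep_of, inner_unitary_left, inv_inv]
  | add a b ha hb =>
    simp only [groupRingStar_add, map_add, add_apply, inner_add_left, inner_add_right,
      ha, hb]
  | smul r a ha =>
    simp only [groupRingStar_smul, map_smul, smul_apply, inner_smul_left_eq_smul,
      inner_smul_right_eq_smul, ha]

theorem norm_sub_inv (π : Γ →* (H ≃ₗᵢ[ℂ] H)) (g : Γ) (ξ : H) :
    ‖π g⁻¹ ξ - ξ‖ = ‖π g ξ - ξ‖ := by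
  rw [← (π g).norm_map, map_sub, ← unitaryRep_mul_apply, norm_sub_rev]
  simp

theorem re_inner_sub_unitary (π : Γ →* (H ≃ₗᵢ[ℂ] H)) (g : Γ) (ξ : H) :
    (⟪ξ - π g ξ, ξ⟫_ℂ).re = ‖π g ξ - ξ‖ ^ 2 / 2 := by
  have h1 := @norm_sub_sq ℂ H _ _ _ (π g ξ) ξ
  have h2 := @inner_self_eq_norm_sq ℂ H _ _ _ ξ
  rw [LinearIsometryEquiv.norm_map] at h1
  rw [inner_sub_left, Complex.sub_re]
  simp only [RCLike.re_to_complex] at h1 h2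
  linarith

theorem laplacian_isPositive (π : Γ →* (H ≃ₗᵢ[ℂ] H)) {S : Finset Γ} (hS : ∀ s ∈ S, s⁻¹ ∈ S) :
    (groupRingRep π (groupLaplacian S)).IsPositive := by
  refine ⟨fun ξ η => ?_, fun ξ => ?_⟩
  · simp only [ContinuousLinearMap.coe_coe, groupRingRep_laplacian, sum_inner, inner_sum,
      inner_sub_left, inner_sub_right, Finset.sum_sub_distrib, inner_unitary_left]
    congr 1
    exact Finset.sum_nbij' (fun s => s⁻¹) (fun s => s⁻¹) hS hS (by simp) (by simp) (by simp)
  · simp only [ContinuousLinearMap.reApplyInnerSelf_apply, groupRingRep_laplacian, sum_inner, map_sum]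
    refine Finset.sum_nonneg fun s _ => ?_
    have := re_inner_sub_unitary π s ξ
    simp only [RCLike.re_to_complex, this]
    positivity

theorem re_inner_laplacian (π : Γ →* (H ≃ₗᵢ[ℂ] H)) (S : Finset Γ) (ξ : H) :
    (⟪groupRingRep π (groupLaplacian S) ξ, ξ⟫_ℂ).re = (∑ s ∈ S, ‖π s ξ - ξ‖ ^ 2) / 2 := by
  rw [groupRingRep_laplacian, sum_inner, Complex.re_sum, Finset.sum_div]
  exact Finset.sum_congr rfl fun s _ => re_inner_sub_unitary π s ξ

theorem eq_zero_of_laplacian_eq_zero {π : Γ →* (H ≃ₗᵢ[ℂ] H)} (hπ : HasNoInvariantVector π)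
    {S : Finset Γ} (hgen : Subgroup.closure (S : Set Γ) = ⊤) {ξ : H}
    (hξ : groupRingRep π (groupLaplacian S) ξ = 0) : ξ = 0 := by
  have h := re_inner_laplacian π S ξ
  rw [hξ, inner_zero_left, Complex.zero_re, eq_comm, div_eq_zero_iff,
    Finset.sum_eq_zero_iff_of_nonneg (fun _ _ => by positivity)] at h
  have hfix : ∀ s ∈ S, π s ξ = ξ := fun s hs => by
    simpa [sub_eq_zero] using (h.resolve_right two_ne_zero) s hs
  refine hπ ξ fun g => ?_
  have hg : g ∈ Subgroup.closure (S : Set Γ) := hgen ▸ Subgroup.mem_top g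
  induction hg using Subgroup.closure_induction with
  | mem x hx => exact hfix x hx
  | one => simp
  | mul x y _ _ hx hy => rw [unitaryRep_mul_apply, hy, hx]
  | inv x _ hx =>
    have := norm_sub_inv π x ξ
    rw [hx, sub_self, norm_zero, norm_eq_zero, sub_eq_zero] at this
    exact this

variable [CompleteSpace H]

/-- A decomposition of `Δ² - ε Δ` into hermitian squares forces the spectral gap `ε` for `Δ` in
every representation without invariant vectors. -/
theorem sum_norm_sq_ge_of_isSumOfHermitianSquares {π : Γ →* (H ≃ₗᵢ[ℂ] H)}
    (hπ : HasNoInvariantVector π) {S : Finset Γ} (hS : ∀ s ∈ S, s⁻¹ ∈ S)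
    (hgen : Subgroup.closure (S : Set Γ) = ⊤) {ε : ℝ}
    (hsos : IsSumOfHermitianSquares (groupLaplacian S ^ 2 - ε • groupLaplacian S)) (ξ : H) :
    2 * ε * ‖ξ‖ ^ 2 ≤ ∑ s ∈ S, ‖π s ξ - ξ‖ ^ 2 := by
  have hpos := laplacian_isPositive π hS
  have key := hpos.gap_of_injective (fun ξ hξ => eq_zero_of_laplacian_eq_zero hπ hgen hξ)
    (ε := ε) (fun ξ => ?_) ξ
  · rw [re_inner_laplacian] at key; linarith
  · obtain ⟨n, b, hb⟩ := hsos
    have h1 : (⟪groupRingRep π (groupLaplacian S ^ 2 - ε • groupLaplacian S) ξ, ξ⟫_ℂ).re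
        = ‖groupRingRep π (groupLaplacian S) ξ‖ ^ 2
          - ε * (⟪groupRingRep π (groupLaplacian S) ξ, ξ⟫_ℂ).re := by
      rw [map_sub, map_pow, map_smul, pow_two, sub_apply,
        mul_apply_eq_comp, smul_apply, inner_sub_left,
        hpos.inner_left_eq_inner_right, Complex.sub_re, ← @inner_self_eq_norm_sq ℂ,
        inner_smul_left_eq_smul, Complex.smul_re, smul_eq_mul]
      rfl
    have h2 : 0 ≤ (⟪groupRingRep π (groupLaplacian S ^ 2 - ε • groupLaplacian S) ξ, ξ⟫_ℂ).re := by
      rw [hb, map_sum, sum_apply, sum_inner, Complex.re_sum]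
      refine Finset.sum_nonneg fun i _ => ?_
      rw [map_mul, mul_apply_eq_comp, inner_groupRingRep_star]
      exact inner_self_nonneg (𝕜 := ℂ)
    linarith

end Representation

/-! ### Kazhdan constants from sums of squares -/

section KazhdanBound

variable {Γ : Type*} [Group Γ]

theorem le_kazhdanConstant_of_isSumOfHermitianSquares {S : Finset Γ} (hS : ∀ s ∈ S, s⁻¹ ∈ S)
    (hne : S.Nonempty) (hgen : Subgroup.closure (S : Set Γ) = ⊤) {ε : ℝ}
    (hsos : IsSumOfHermitianSquares (groupLaplacian S ^ 2 - ε • groupLaplacian S)) :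
    ENNReal.ofReal (Real.sqrt (2 * ε / (S.card : ℝ))) ≤ kazhdanConstant.{u} S := by
  refine le_sInf ?_
  rintro _ ⟨H, _, _, _, π, hπ, rfl⟩
  refine le_iInf₂ fun ξ hξ => ?_
  have hsum := sum_norm_sq_ge_of_isSumOfHermitianSquares hπ hS hgen hsos ξ
  rw [hξ, one_pow, mul_one] at hsum
  obtain ⟨s, hs, hle⟩ := Finset.exists_le_of_sum_le hne
    (f := fun _ => 2 * ε / (S.card : ℝ)) (g := fun s => ‖π s ξ - ξ‖ ^ 2) (by
      have : (S.card : ℝ) ≠ 0 := by exact_mod_cast hne.card_ne_zero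
      rw [Finset.sum_const, nsmul_eq_mul, mul_div_cancel₀ _ this]
      exact hsum)
  refine le_trans (ENNReal.ofReal_le_ofReal ?_)
    (le_iSup₂ (f := fun s (_ : s ∈ S) => ENNReal.ofReal ‖π s ξ - ξ‖) s hs)
  exact Real.sqrt_le_iff.2 ⟨norm_nonneg _, hle⟩

/-- Passing from `S` to `T` does not change the displacement of a vector when every element of
`S` lies in `T` up to inversion. -/
theorem kazhdanConstant_le_of_mem_or_inv_mem {S T : Finset Γ} (h : ∀ s ∈ S, s ∈ T ∨ s⁻¹ ∈ T) :
    kazhdanConstant.{u} S ≤ kazhdanConstant.{u} T := by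
  refine le_sInf ?_
  rintro _ ⟨H, i1, i2, i3, π, hπ, rfl⟩
  have hle : kazhdanConstant.{u} S ≤ kazhdanConstantRep S π :=
    sInf_le ⟨H, i1, i2, i3, π, hπ, rfl⟩
  refine hle.trans ?_
  refine iInf₂_mono fun ξ _ => iSup₂_le fun s hs => ?_
  rcases h s hs with h | h
  · exact le_iSup₂ (f := fun s (_ : s ∈ T) => ENNReal.ofReal ‖π s ξ - ξ‖) s h
  · rw [← norm_sub_inv]
    exact le_iSup₂ (f := fun s (_ : s ∈ T) => ENNReal.ofReal ‖π s ξ - ξ‖) s⁻¹ h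

end KazhdanBound

/-! ### The cone of sums of hermitian squares -/

section HermitianSquares

variable {Γ : Type*} [Group Γ]

theorem IsSumOfHermitianSquares.zero : IsSumOfHermitianSquares (0 : MonoidAlgebra ℝ Γ) :=
  ⟨0, Fin.elim0, by simp⟩

theorem isSumOfHermitianSquares_star_mul_self (b : MonoidAlgebra ℝ Γ) :
    IsSumOfHermitianSquares (groupRingStar b * b) :=
  ⟨1, fun _ => b, by simp⟩

theorem IsSumOfHermitianSquares.add {a b : MonoidAlgebra ℝ Γ} (ha : IsSumOfHermitianSquares a)
    (hb : IsSumOfHermitianSquares b) : IsSumOfHermitianSquares (a + b) := by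
  obtain ⟨m, c, rfl⟩ := ha
  obtain ⟨n, d, rfl⟩ := hb
  exact ⟨m + n, Fin.append c d, by simp [Fin.sum_univ_add]⟩

theorem IsSumOfHermitianSquares.smul {a : MonoidAlgebra ℝ Γ} (ha : IsSumOfHermitianSquares a)
    {r : ℝ} (hr : 0 ≤ r) : IsSumOfHermitianSquares (r • a) := by
  obtain ⟨m, c, rfl⟩ := ha
  refine ⟨m, fun i => Real.sqrt r • c i, ?_⟩
  simp only [groupRingStar_smul, smul_mul_smul_comm, Real.mul_self_sqrt hr, Finset.smul_sum]

theorem IsSumOfHermitianSquares.sum {ι : Type*} {s : Finset ι} {f : ι → MonoidAlgebra ℝ Γ}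
    (h : ∀ i ∈ s, IsSumOfHermitianSquares (f i)) : IsSumOfHermitianSquares (∑ i ∈ s, f i) :=
  Finset.sum_induction f _ (fun _ _ => .add) .zero h

theorem IsSumOfHermitianSquares.list_sum {l : List (MonoidAlgebra ℝ Γ)}
    (h : ∀ a ∈ l, IsSumOfHermitianSquares a) : IsSumOfHermitianSquares l.sum :=
  List.sum_induction _ (fun _ _ => .add) .zero h

end HermitianSquares

/-! ### Automorphisms acting on the group ring -/

section Automorphisms

variable {Γ : Type*} [Group Γ]

/-- The action of an automorphism of `Γ` on the real group ring. -/
noncomputable def groupRingAut (α : MulAut Γ) : MonoidAlgebra ℝ Γ ≃ₐ[ℝ] MonoidAlgebra ℝ Γ :=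
  MonoidAlgebra.domCongr ℝ ℝ α

theorem groupRingAut_of (α : MulAut Γ) (g : Γ) :
    groupRingAut α (MonoidAlgebra.of ℝ Γ g) = MonoidAlgebra.of ℝ Γ (α g) := by
  simp [groupRingAut]

theorem groupRingAut_mul_apply (α β : MulAut Γ) (a : MonoidAlgebra ℝ Γ) :
    groupRingAut (α * β) a = groupRingAut α (groupRingAut β a) := by
  induction a using MonoidAlgebra.induction_on with
  | of g => simp only [groupRingAut_of, MulAut.mul_apply]
  | add a b ha hb => simp only [map_add, ha, hb]
  | smul r a ha => simp only [map_smul, ha]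

theorem groupRingAut_involutive {α : MulAut Γ} (hα : α * α = 1) (a : MonoidAlgebra ℝ Γ) :
    groupRingAut α (groupRingAut α a) = a := by
  rw [← groupRingAut_mul_apply, hα]
  induction a using MonoidAlgebra.induction_on with
  | of g => simp only [groupRingAut_of, MulAut.one_apply]
  | add a b ha hb => simp only [map_add, ha, hb]
  | smul r a ha => simp only [map_smul, ha]

theorem groupRingAut_star (α : MulAut Γ) (a : MonoidAlgebra ℝ Γ) :
    groupRingAut α (groupRingStar a) = groupRingStar (groupRingAut α a) := by
  induction a using MonoidAlgebra.induction_on with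
  | of g => simp only [groupRingAut_of, groupRingStar_of, map_inv]
  | add a b ha hb => simp only [map_add, groupRingStar_add, ha, hb]
  | smul r a ha => simp only [map_smul, groupRingStar_smul, ha]

/-- The automorphisms of `Γ` that preserve the set `S`. -/
def autPreserving (S : Finset Γ) : Subgroup (MulAut Γ) where
  carrier := {α | ∀ g, α g ∈ S ↔ g ∈ S}
  one_mem' := fun _ => Iff.rfl
  mul_mem' := fun {α β} hα hβ g => (hα (β g)).trans (hβ g)
  inv_mem' := fun {α} hα g => by simpa using (hα (α⁻¹ g)).symm

theorem finite_autPreserving {S : Finset Γ} (hgen : Subgroup.closure (S : Set Γ) = ⊤) :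
    Finite (autPreserving S) := by
  refine Finite.of_injective
    (fun (α : autPreserving S) (s : S) => (⟨α.1 s, (α.2 s).2 s.2⟩ : S)) ?_
  intro α β h
  ext g : 2
  have hEq : Set.EqOn α.1.toMonoidHom β.1.toMonoidHom (S : Set Γ) := fun s hs =>
    congrArg Subtype.val (congrFun h ⟨s, hs⟩)
  exact DFunLike.congr_fun (MonoidHom.eq_of_eqOn_dense hgen hEq) g

end Automorphisms

/-! ### Symmetrization over a finite group of automorphisms -/

section Symmetrization

variable {Γ : Type*} [Group Γ] (G : Subgroup (MulAut Γ)) [Fintype G]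

/-- The sum of all images of a group ring element under the automorphisms in `G` and the
`*`-operation. -/
noncomputable def symmSum : MonoidAlgebra ℝ Γ →ₗ[ℝ] MonoidAlgebra ℝ Γ :=
  ∑ α : G, (groupRingAut α.1).toLinearMap ∘ₗ (LinearMap.id + groupRingStarLinear)

theorem symmSum_apply (a : MonoidAlgebra ℝ Γ) :
    symmSum G a = ∑ α : G, groupRingAut α.1 (a + groupRingStar a) := by
  simp [symmSum, groupRingStarLinear]

variable {G}

theorem symmSum_aut {α : MulAut Γ} (hα : α ∈ G) (a : MonoidAlgebra ℝ Γ) :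
    symmSum G (groupRingAut α a) = symmSum G a := by
  simp only [symmSum_apply, ← groupRingAut_star, ← map_add, ← groupRingAut_mul_apply]
  exact Fintype.sum_equiv (Equiv.mulRight (⟨α, hα⟩ : G)) _ _ fun _ => rfl

theorem symmSum_star (a : MonoidAlgebra ℝ Γ) : symmSum G (groupRingStar a) = symmSum G a := by
  simp only [symmSum_apply, groupRingStar_star, add_comm]

theorem symmSum_of_inv (g : Γ) :
    symmSum G (MonoidAlgebra.of ℝ Γ g⁻¹) = symmSum G (MonoidAlgebra.of ℝ Γ g) := by
  rw [← groupRingStar_of, symmSum_star]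

theorem symmSum_of_aut {α : MulAut Γ} (hα : α ∈ G) (g : Γ) :
    symmSum G (MonoidAlgebra.of ℝ Γ (α g)) = symmSum G (MonoidAlgebra.of ℝ Γ g) := by
  rw [← groupRingAut_of, symmSum_aut hα]

theorem isSumOfHermitianSquares_symmSum_star_mul_self (b : MonoidAlgebra ℝ Γ) :
    IsSumOfHermitianSquares (symmSum G (groupRingStar b * b)) := by
  rw [symmSum_apply]
  refine .sum fun α _ => ?_
  rw [groupRingStar_mul, groupRingStar_star, map_add, map_mul, groupRingAut_star]
  exact .add (isSumOfHermitianSquares_star_mul_self _) (isSumOfHermitianSquares_star_mul_self _)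

/-- The symmetrization of `2 (1 - g)` is that of `(1 - g)^* (1 - g)`. -/
theorem isSumOfHermitianSquares_symmSum_one_sub (g : Γ) :
    IsSumOfHermitianSquares
      (symmSum G (MonoidAlgebra.of ℝ Γ 1) - symmSum G (MonoidAlgebra.of ℝ Γ g)) := by
  have h : groupRingStar (MonoidAlgebra.of ℝ Γ 1 - MonoidAlgebra.of ℝ Γ g) *
      (MonoidAlgebra.of ℝ Γ 1 - MonoidAlgebra.of ℝ Γ g) =
      (2 : ℝ) • MonoidAlgebra.of ℝ Γ 1 - MonoidAlgebra.of ℝ Γ g - MonoidAlgebra.of ℝ Γ g⁻¹ := by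
    rw [sub_eq_add_neg (MonoidAlgebra.of ℝ Γ 1), ← neg_one_smul ℝ, groupRingStar_add,
      groupRingStar_smul, groupRingStar_of, groupRingStar_of]
    simp only [add_mul, mul_add, smul_mul_assoc, mul_smul_comm, ← map_mul, inv_one, one_mul,
      mul_one, inv_mul_cancel]
    module
  have h2 := (isSumOfHermitianSquares_symmSum_star_mul_self (G := G)
    (MonoidAlgebra.of ℝ Γ 1 - MonoidAlgebra.of ℝ Γ g)).smul (r := 1 / 2) (by norm_num)
  rw [h, map_sub, map_sub, map_smul, symmSum_of_inv] at h2
  convert h2 using 1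
  module

/-- An element that is fixed by `G` and by `*` is a multiple of its symmetrization. -/
theorem IsSumOfHermitianSquares.of_symmSum {a : MonoidAlgebra ℝ Γ}
    (haut : ∀ α ∈ G, groupRingAut α a = a) (hstar : groupRingStar a = a)
    (h : IsSumOfHermitianSquares (symmSum G a)) : IsSumOfHermitianSquares a := by
  have hcard : (Fintype.card G : ℝ) ≠ 0 := by exact_mod_cast Fintype.card_ne_zero
  have hsum : symmSum G a = (2 * (Fintype.card G : ℝ)) • a := by
    rw [symmSum_apply, Finset.sum_congr rfl fun α _ => by
      rw [hstar, map_add, haut α.1 α.2], Finset.sum_const, Finset.card_univ,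
      ← Nat.cast_smul_eq_nsmul ℝ]
    module
  have h2 := h.smul (r := (2 * (Fintype.card G : ℝ))⁻¹) (by positivity)
  rwa [hsum, smul_smul, inv_mul_cancel₀ (by positivity), one_smul] at h2

/-- The operator `1 + e α`; for an involution `α` and a sign `e` it is twice the projection to the
`e`-eigenspace of `α`. -/
noncomputable def twist (e : ℤ) (α : MulAut Γ) : MonoidAlgebra ℝ Γ →ₗ[ℝ] MonoidAlgebra ℝ Γ :=
  LinearMap.id + (e : ℝ) • (groupRingAut α).toLinearMap

theorem twist_apply (e : ℤ) (α : MulAut Γ) (a : MonoidAlgebra ℝ Γ) :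
    twist e α a = a + (e : ℝ) • groupRingAut α a := by
  simp [twist]

theorem twist_twist {e : ℤ} (he : e * e = 1) {α : MulAut Γ} (hα : α * α = 1)
    (a : MonoidAlgebra ℝ Γ) : twist e α (twist e α a) = (2 : ℝ) • twist e α a := by
  have he' : (e : ℝ) * e = 1 := by exact_mod_cast he
  have h1 := groupRingAut_involutive hα a
  simp only [twist_apply, map_add, map_smul, h1, smul_add, smul_smul, he']
  module

theorem twist_comm (e f : ℤ) {α β : MulAut Γ} (h : α * β = β * α) (a : MonoidAlgebra ℝ Γ) :
    twist e α (twist f β a) = twist f β (twist e α a) := by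
  simp only [twist_apply, map_add, map_smul, ← groupRingAut_mul_apply, h]
  module

/-- `1 + e α` is symmetric for the form `(a, b) ↦ symmSum (a^* b)`. -/
theorem symmSum_star_twist_mul (e : ℤ) {α : MulAut Γ} (hG : α ∈ G) (hα : α * α = 1)
    (a b : MonoidAlgebra ℝ Γ) :
    symmSum G (groupRingStar (twist e α a) * b) = symmSum G (groupRingStar a * twist e α b) := by
  have h1 := groupRingAut_involutive hα b
  have h2 : symmSum G (groupRingStar (groupRingAut α a) * b) =
      symmSum G (groupRingStar a * groupRingAut α b) := by
    rw [← symmSum_aut hG (groupRingStar a * groupRingAut α b), map_mul (groupRingAut α), h1,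
      groupRingAut_star]
  simp only [twist_apply, groupRingStar_add, groupRingStar_smul, add_mul, mul_add,
    smul_mul_assoc, mul_smul_comm, map_add, map_smul, h2]

/-- Three commuting involutions in `G` with signs `e, f, g` give, up to a factor `8`, a
self-adjoint idempotent operator, so that `a^* P a` symmetrizes to a sum of squares. -/
theorem isSumOfHermitianSquares_symmSum_star_mul_twist {e f g : ℤ} (he : e * e = 1)
    (hf : f * f = 1) (hg : g * g = 1) {α β γ : MulAut Γ} (hα : α ∈ G) (hβ : β ∈ G) (hγ : γ ∈ G)
    (hα2 : α * α = 1) (hβ2 : β * β = 1) (hγ2 : γ * γ = 1) (hαβ : α * β = β * α)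
    (hαγ : α * γ = γ * α) (hβγ : β * γ = γ * β) (a : MonoidAlgebra ℝ Γ) :
    IsSumOfHermitianSquares
      (symmSum G (groupRingStar a * twist e α (twist f β (twist g γ a)))) := by
  have h := (isSumOfHermitianSquares_symmSum_star_mul_self (G := G)
    (twist e α (twist f β (twist g γ a)))).smul (r := 1 / 8) (by norm_num)
  rw [symmSum_star_twist_mul e hα hα2, symmSum_star_twist_mul f hβ hβ2,
    symmSum_star_twist_mul g hγ hγ2, twist_twist he hα2, map_smul, map_smul,
    twist_comm f e hαβ.symm, twist_twist hf hβ2, map_smul, map_smul,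
    twist_comm g e hαγ.symm, twist_comm g f hβγ.symm, twist_twist hg hγ2] at h
  simpa only [map_smul, mul_smul_comm, smul_smul, show (1 / 8 : ℝ) * (2 * (2 * 2)) = 1 by norm_num,
    one_smul] using h

end Symmetrization

/-! ### Invariance of the Laplacian -/

section Laplacian

variable {Γ : Type*} [Group Γ] {S : Finset Γ}

theorem groupRingAut_laplacian {α : MulAut Γ} (hα : α ∈ autPreserving S) :
    groupRingAut α (groupLaplacian S) = groupLaplacian S := by
  simp only [groupLaplacian, map_sub, map_smul, map_one, map_sum, groupRingAut_of]
  congr 1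
  exact Finset.sum_nbij' (fun s => α s) (fun s => α⁻¹ s) (fun s hs => (hα s).2 hs)
    (fun s hs => ((autPreserving S).inv_mem hα s).2 hs) (by simp) (by simp) (by simp)

theorem groupRingStar_laplacian (hS : ∀ s ∈ S, s⁻¹ ∈ S) :
    groupRingStar (groupLaplacian S) = groupLaplacian S := by
  have h1 : groupRingStar (1 : MonoidAlgebra ℝ Γ) = 1 := by
    rw [← map_one (MonoidAlgebra.of ℝ Γ), groupRingStar_of, inv_one]
  rw [groupLaplacian, sub_eq_add_neg, ← neg_one_smul ℝ, groupRingStar_add, groupRingStar_smul,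
    groupRingStar_smul, h1, groupRingStar_sum, Finset.sum_congr rfl fun s _ => groupRingStar_of s]
  congr 2
  exact Finset.sum_nbij' (fun s => s⁻¹) (fun s => s⁻¹) hS hS (by simp) (by simp) (by simp)

end Laplacian

/-! ### Steinberg relations for signed generators -/

section Letters

/-- A letter `(i, j, b)` stands for `x_ij` if `b` is `false` and for `x_ij⁻¹` if `b` is `true`. -/
abbrev Letter : Type := Fin 3 × Fin 3 × Bool

/-- The generator `x_ij` of `St_3(ℤ)`, with the convention `x_ii = 1`. -/
noncomputable def steinbergX (i j : Fin 3) : SteinbergGroup 3 :=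
  if h : i ≠ j then steinbergGen ⟨(i, j), h⟩ else 1

/-- The element of `St_3(ℤ)` that a letter stands for. -/
noncomputable def letterEval (l : Letter) : SteinbergGroup 3 :=
  bif l.2.2 then (steinbergX l.1 l.2.1)⁻¹ else steinbergX l.1 l.2.1

/-- The inverse letter. -/
def letterInv (l : Letter) : Letter := (l.1, l.2.1, !l.2.2)

theorem letterEval_inv (l : Letter) : letterEval (letterInv l) = (letterEval l)⁻¹ := by
  obtain ⟨i, j, b⟩ := l
  cases b <;> simp [letterEval, letterInv]

theorem steinbergX_of_ne {i j : Fin 3} (h : i ≠ j) : steinbergX i j = steinbergGen ⟨(i, j), h⟩ :=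
  dif_pos h

theorem steinbergX_self (i : Fin 3) : steinbergX i i = 1 := by
  simp [steinbergX]

theorem steinbergX_commute {i j k l : Fin 3} (hil : i ≠ l) (hjk : j ≠ k) :
    Commute (steinbergX i j) (steinbergX k l) := by
  rcases eq_or_ne i j with rfl | hij
  · rw [steinbergX_self]; exact Commute.one_left _
  rcases eq_or_ne k l with rfl | hkl
  · rw [steinbergX_self]; exact Commute.one_right _
  rw [← commutatorElement_eq_one_iff_commute, steinbergX_of_ne hij, steinbergX_of_ne hkl]
  exact PresentedGroup.one_of_mem (rels := steinbergRelators 3)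
    (Or.inr ⟨i, j, k, l, hij, hkl, hil, hjk, rfl⟩)

theorem steinbergX_commutator {i j k : Fin 3} (hij : i ≠ j) (hjk : j ≠ k) (hik : i ≠ k) :
    ⁅steinbergX i j, steinbergX j k⁆ = steinbergX i k := by
  rw [steinbergX_of_ne hij, steinbergX_of_ne hjk, steinbergX_of_ne hik, ← mul_inv_eq_one]
  exact PresentedGroup.one_of_mem (rels := steinbergRelators 3)
    (Or.inl ⟨i, j, k, hij, hjk, hik, rfl⟩)

/-- If `z = [x, y]` commutes with `x`, then `z = x⁻¹ z x = [x⁻¹, y]⁻¹`. -/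
theorem commutatorElement_inv_left_of_commute {G : Type*} [Group G] {x y z : G} (h : ⁅x, y⁆ = z)
    (hx : Commute x z) : ⁅x⁻¹, y⁆ = z⁻¹ := by
  subst h
  have h1 : x⁻¹ * ⁅x, y⁆ * x = ⁅x, y⁆ := by rw [mul_assoc, ← hx.eq, inv_mul_cancel_left]
  rw [← h1]
  simp only [commutatorElement_def]
  group

theorem commutatorElement_inv_right_of_commute {G : Type*} [Group G] {x y z : G} (h : ⁅x, y⁆ = z)
    (hy : Commute y z) : ⁅x, y⁻¹⁆ = z⁻¹ := by
  have h1 : ⁅y, x⁆ = z⁻¹ := by rw [← h, commutatorElement_inv]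
  rw [← commutatorElement_inv, commutatorElement_inv_left_of_commute h1 hy.inv_right, inv_inv]

theorem letterEval_commute {l m : Letter} (h₁ : l.1 ≠ m.2.1) (h₂ : l.2.1 ≠ m.1) :
    Commute (letterEval l) (letterEval m) := by
  have h := steinbergX_commute h₁ h₂
  obtain ⟨i, j, a⟩ := l
  obtain ⟨k, l, b⟩ := m
  cases a <;> cases b
  · exact h
  · exact h.inv_right
  · exact h.inv_left
  · exact h.inv_inv

theorem letterEval_commutator {i j k : Fin 3} (hij : i ≠ j) (hjk : j ≠ k) (hik : i ≠ k)
    (a b : Bool) : ⁅letterEval (i, j, a), letterEval (j, k, b)⁆ = letterEval (i, k, xor a b) := by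
  have h := steinbergX_commutator hij hjk hik
  have h₁ : Commute (steinbergX i j) (steinbergX i k) := steinbergX_commute hik hij.symm
  have h₂ : Commute (steinbergX j k) (steinbergX i k) := steinbergX_commute hjk hik.symm
  have h' := commutatorElement_inv_right_of_commute h h₂
  cases a <;> cases b
  · exact h
  · exact h'
  · exact commutatorElement_inv_left_of_commute h h₁
  · exact (commutatorElement_inv_left_of_commute h' h₁.inv_right).trans (inv_inv _)

theorem steinbergGroup_hom_ext {M : Type*} [Group M] {f g : SteinbergGroup 3 →* M}
    (h : ∀ l, f (letterEval l) = g (letterEval l)) : f = g := by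
  refine PresentedGroup.ext (rels := steinbergRelators 3) fun p => ?_
  have hp : letterEval (p.1.1, p.1.2, false) = PresentedGroup.of p := steinbergX_of_ne p.2
  rw [← hp]
  exact h _

end Letters

/-! ### Signed permutations and the inverse transpose as automorphisms -/

section Symmetries

/-- The data of an automorphism of `St_3(ℤ)`: a permutation of the indices and a choice of signs,
both acting by conjugation as for matrices, and `flip` for the inverse transpose. -/
structure SteinbergSymm where
  perm : Equiv.Perm (Fin 3)
  sign : Fin 3 → Bool
  flip : Bool

namespace SteinbergSymm

/-- The action on letters. The sign change comes first, then the inverse transpose, then the permutation. -/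
def act (σ : SteinbergSymm) (l : Letter) : Letter :=
  bif σ.flip then (σ.perm l.2.1, σ.perm l.1, !(xor l.2.2 (xor (σ.sign l.1) (σ.sign l.2.1))))
  else (σ.perm l.1, σ.perm l.2.1, xor l.2.2 (xor (σ.sign l.1) (σ.sign l.2.1)))

/-- The inverse symmetry. -/
def inv (σ : SteinbergSymm) : SteinbergSymm :=
  ⟨σ.perm⁻¹, fun i => σ.sign (σ.perm⁻¹ i), σ.flip⟩

theorem act_inv_act (σ : SteinbergSymm) (l : Letter) : σ.inv.act (σ.act l) = l := by
  obtain ⟨i, j, b⟩ := l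
  cases hf : σ.flip
  · simp [act, inv, hf]
  · simp [act, inv, hf, Bool.xor_comm (σ.sign j)]

theorem act_act_inv (σ : SteinbergSymm) (l : Letter) : σ.act (σ.inv.act l) = l := by
  obtain ⟨i, j, b⟩ := l
  cases hf : σ.flip
  · simp [act, inv, hf]
  · simp [act, inv, hf]

theorem act_letterInv (σ : SteinbergSymm) (l : Letter) :
    σ.act (letterInv l) = letterInv (σ.act l) := by
  cases hf : σ.flip <;> simp [act, letterInv, hf]

theorem act_valid (σ : SteinbergSymm) {l : Letter} (h : l.1 ≠ l.2.1) :
    (σ.act l).1 ≠ (σ.act l).2.1 := by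
  cases hf : σ.flip
  · simpa [act, hf] using h
  · simpa [act, hf] using h.symm

theorem act_commutator (σ : SteinbergSymm) {i j k : Fin 3} (hij : i ≠ j) (hjk : j ≠ k)
    (hik : i ≠ k) (a b : Bool) :
    ⁅letterEval (σ.act (i, j, a)), letterEval (σ.act (j, k, b))⁆ =
      letterEval (σ.act (i, k, xor a b)) := by
  have inj : ∀ {x y}, σ.perm x ≠ σ.perm y ↔ x ≠ y := σ.perm.injective.ne_iff
  cases hf : σ.flip
  · simp only [act, hf, cond_false]
    rw [letterEval_commutator (inj.2 hij) (inj.2 hjk) (inj.2 hik)]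
    congr 3
    cases a <;> cases b <;> cases σ.sign i <;> cases σ.sign j <;> cases σ.sign k <;> rfl
  · simp only [act, hf, cond_true]
    rw [← commutatorElement_inv, letterEval_commutator (inj.2 hjk.symm) (inj.2 hij.symm)
      (inj.2 hik.symm), ← letterEval_inv, letterInv]
    congr 3
    cases a <;> cases b <;> cases σ.sign i <;> cases σ.sign j <;> cases σ.sign k <;> rfl

theorem act_commute (σ : SteinbergSymm) {l m : Letter} (h₁ : l.1 ≠ m.2.1) (h₂ : l.2.1 ≠ m.1) :
    Commute (letterEval (σ.act l)) (letterEval (σ.act m)) := by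
  have inj : ∀ {x y}, σ.perm x ≠ σ.perm y ↔ x ≠ y := σ.perm.injective.ne_iff
  refine letterEval_commute ?_ ?_
  · cases hf : σ.flip
    · simpa [act, hf] using h₁
    · simpa [act, hf] using h₂
  · cases hf : σ.flip
    · simpa [act, hf] using h₂
    · simpa [act, hf] using h₁

/-- The endomorphism of `St_3(ℤ)` induced by a symmetry. -/
noncomputable def hom (σ : SteinbergSymm) : SteinbergGroup 3 →* SteinbergGroup 3 :=
  PresentedGroup.toGroup (f := fun p : SteinbergIndex 3 =>
    letterEval (σ.act (p.1.1, p.1.2, false))) (by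
    rintro r (⟨i, j, k, hij, hjk, hik, rfl⟩ | ⟨i, j, k, l, hij, hkl, hil, hjk, rfl⟩)
    · simp only [map_mul, map_inv, map_commutatorElement, steinbergFreeGen, FreeGroup.lift_apply_of]
      rw [mul_inv_eq_one]
      exact σ.act_commutator hij hjk hik false false
    · simp only [map_commutatorElement, steinbergFreeGen, FreeGroup.lift_apply_of]
      rw [commutatorElement_eq_one_iff_commute]
      exact σ.act_commute (l := (i, j, false)) (m := (k, l, false)) hil hjk)

theorem hom_letterEval (σ : SteinbergSymm) (l : Letter) :
    σ.hom (letterEval l) = letterEval (σ.act l) := by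
  have key : ∀ i j, σ.hom (letterEval (i, j, false)) = letterEval (σ.act (i, j, false)) := by
    intro i j
    rcases eq_or_ne i j with rfl | hij
    · cases hf : σ.flip <;> simp [letterEval, act, hf, steinbergX_self]
    · have : letterEval (i, j, false) = PresentedGroup.of ⟨(i, j), hij⟩ := steinbergX_of_ne hij
      rw [this, hom, PresentedGroup.toGroup.of]
  obtain ⟨i, j, b⟩ := l
  cases b
  · exact key i j
  · rw [show ((i, j, true) : Letter) = letterInv (i, j, false) from rfl, letterEval_inv, map_inv,
      key, act_letterInv, letterEval_inv]

/-- The automorphism of `St_3(ℤ)` induced by a symmetry. -/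
noncomputable def aut (σ : SteinbergSymm) : MulAut (SteinbergGroup 3) :=
  MonoidHom.toMulEquiv σ.hom σ.inv.hom
    (steinbergGroup_hom_ext fun l => by
      rw [MonoidHom.comp_apply, hom_letterEval, hom_letterEval, act_inv_act, MonoidHom.id_apply])
    (steinbergGroup_hom_ext fun l => by
      rw [MonoidHom.comp_apply, hom_letterEval, hom_letterEval, act_act_inv, MonoidHom.id_apply])

theorem aut_letterEval (σ : SteinbergSymm) (l : Letter) :
    σ.aut (letterEval l) = letterEval (σ.act l) :=
  σ.hom_letterEval l

theorem aut_mul_eq {σ τ σ' τ' : SteinbergSymm}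
    (h : ∀ l, σ.act (τ.act l) = σ'.act (τ'.act l)) : σ.aut * τ.aut = σ'.aut * τ'.aut := by
  refine MulEquiv.toMonoidHom_injective (steinbergGroup_hom_ext fun l => ?_)
  change σ.aut (τ.aut (letterEval l)) = σ'.aut (τ'.aut (letterEval l))
  simp only [aut_letterEval, h]

theorem aut_mul_self {σ : SteinbergSymm} (h : ∀ l, σ.act (σ.act l) = l) : σ.aut * σ.aut = 1 := by
  refine MulEquiv.toMonoidHom_injective (steinbergGroup_hom_ext fun l => ?_)
  change σ.aut (σ.aut (letterEval l)) = letterEval l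
  simp only [aut_letterEval, h]

end SteinbergSymm

end Symmetries

/-! ### The symmetric generating set -/

section GeneratingSet

theorem mem_steinbergSymmGenSet {g : SteinbergGroup 3} :
    g ∈ steinbergSymmGenSet 3 ↔ ∃ l : Letter, l.1 ≠ l.2.1 ∧ letterEval l = g := by
  simp only [steinbergSymmGenSet, steinbergGenSet, Finset.mem_union, Finset.mem_image,
    Finset.mem_univ, true_and]
  constructor
  · rintro (⟨p, rfl⟩ | ⟨_, ⟨p, rfl⟩, rfl⟩)
    · exact ⟨(p.1.1, p.1.2, false), p.2, steinbergX_of_ne p.2⟩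
    · exact ⟨(p.1.1, p.1.2, true), p.2, congrArg Inv.inv (steinbergX_of_ne p.2)⟩
  · rintro ⟨⟨i, j, b⟩, h, rfl⟩
    cases b
    · exact Or.inl ⟨⟨(i, j), h⟩, (steinbergX_of_ne h).symm⟩
    · exact Or.inr ⟨_, ⟨⟨(i, j), h⟩, rfl⟩, congrArg Inv.inv (steinbergX_of_ne h).symm⟩

theorem inv_mem_steinbergSymmGenSet :
    ∀ s ∈ steinbergSymmGenSet 3, s⁻¹ ∈ steinbergSymmGenSet 3 := by
  intro s hs
  obtain ⟨l, hl, rfl⟩ := mem_steinbergSymmGenSet.1 hs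
  exact mem_steinbergSymmGenSet.2 ⟨letterInv l, hl, letterEval_inv l⟩

theorem closure_steinbergGenSet :
    Subgroup.closure (steinbergGenSet 3 : Set (SteinbergGroup 3)) = ⊤ := by
  rw [← PresentedGroup.closure_range_of (steinbergRelators 3)]
  congr 1
  ext g
  simp [steinbergGenSet, steinbergGen]

theorem steinbergGenSet_subset : steinbergGenSet 3 ⊆ steinbergSymmGenSet 3 := by
  classical exact fun _ hs => Finset.mem_union.2 (Or.inl hs)

theorem closure_steinbergSymmGenSet :
    Subgroup.closure (steinbergSymmGenSet 3 : Set (SteinbergGroup 3)) = ⊤ :=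
  top_le_iff.1 (closure_steinbergGenSet ▸ Subgroup.closure_mono (by
    exact_mod_cast steinbergGenSet_subset))

theorem SteinbergSymm.aut_mem (σ : SteinbergSymm) :
    σ.aut ∈ autPreserving (steinbergSymmGenSet 3) := by
  intro g
  simp only [mem_steinbergSymmGenSet]
  constructor
  · rintro ⟨l, hl, h⟩
    refine ⟨σ.inv.act l, σ.inv.act_valid hl, σ.aut.injective ?_⟩
    rw [σ.aut_letterEval, σ.act_act_inv, h]
  · rintro ⟨l, hl, rfl⟩
    exact ⟨σ.act l, σ.act_valid hl, (σ.aut_letterEval l).symm⟩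

/-- The elementary matrix that a letter stands for. -/
def letterSL (l : Letter) (h : l.1 ≠ l.2.1) : Matrix.SpecialLinearGroup (Fin 3) ℤ :=
  ⟨Matrix.transvection l.1 l.2.1 (bif l.2.2 then -1 else 1), Matrix.det_transvection_of_ne _ _ h _⟩

/-- The canonical map from `St_3(ℤ)` to `SL_3(ℤ)`. -/
noncomputable def steinbergToSL : SteinbergGroup 3 →* Matrix.SpecialLinearGroup (Fin 3) ℤ :=
  PresentedGroup.toGroup
    (f := fun p : SteinbergIndex 3 => letterSL (p.1.1, p.1.2, false) p.2) (by
    rintro r (⟨i, j, k, hij, hjk, hik, rfl⟩ | ⟨i, j, k, l, hij, hkl, hil, hjk, rfl⟩)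
    · simp only [map_mul, map_inv, map_commutatorElement, steinbergFreeGen, FreeGroup.lift_apply_of]
      rw [mul_inv_eq_one, commutatorElement_def, mul_inv_eq_iff_eq_mul, mul_inv_eq_iff_eq_mul]
      refine Subtype.ext ?_
      change Matrix.transvection i j 1 * Matrix.transvection j k 1 =
        Matrix.transvection i k 1 * Matrix.transvection j k 1 * Matrix.transvection i j 1
      simp [Matrix.transvection, mul_add, add_mul, hjk.symm, hik.symm]
      abel
    · simp only [map_commutatorElement, steinbergFreeGen, FreeGroup.lift_apply_of]
      rw [commutatorElement_eq_one_iff_mul_comm]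
      refine Subtype.ext ?_
      change Matrix.transvection i j 1 * Matrix.transvection k l 1 =
        Matrix.transvection k l 1 * Matrix.transvection i j 1
      simp [Matrix.transvection, mul_add, add_mul, hjk, hil.symm]
      abel)

theorem steinbergToSL_letterEval {l : Letter} (h : l.1 ≠ l.2.1) :
    steinbergToSL (letterEval l) = letterSL l h := by
  have key : ∀ i j (h : i ≠ j), steinbergToSL (letterEval (i, j, false)) =
      letterSL (i, j, false) h := by
    intro i j h
    have : letterEval (i, j, false) = PresentedGroup.of ⟨(i, j), h⟩ := steinbergX_of_ne h
    rw [this, steinbergToSL, PresentedGroup.toGroup.of]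
  obtain ⟨i, j, b⟩ := l
  cases b
  · exact key i j h
  · have : letterEval (i, j, true) = (letterEval (i, j, false))⁻¹ :=
      letterEval_inv (i, j, false)
    rw [this, map_inv, key i j h]
    refine inv_eq_of_mul_eq_one_right (Subtype.ext ?_)
    exact (Matrix.transvection_mul_transvection_same i j h 1 (-1)).trans (by simp)

theorem letterEval_injOn : Set.InjOn letterEval {l : Letter | l.1 ≠ l.2.1} := by
  intro l hl m hm h
  have h1 : letterSL l hl = letterSL m hm := by
    rw [← steinbergToSL_letterEval, ← steinbergToSL_letterEval, h]
  obtain ⟨i, j, a⟩ := l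
  obtain ⟨k, l, b⟩ := m
  have hij : i ≠ j := hl
  -- compare the entries at the position of the first letter
  have h2 := congrFun₂ (congrArg Subtype.val h1) i j
  simp only [letterSL, Matrix.transvection, Matrix.add_apply, Matrix.one_apply_ne hij, zero_add,
    Matrix.single_apply, and_self, if_true] at h2
  by_cases hkl : k = i ∧ l = j
  · obtain ⟨rfl, rfl⟩ := hkl
    cases a <;> cases b <;> simp_all
  · rw [if_neg hkl] at h2
    cases a <;> simp_all

/-- The twelve letters. -/
def letters : List Letter :=
  [(0, 1, false), (0, 1, true), (0, 2, false), (0, 2, true), (1, 0, false), (1, 0, true),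
    (1, 2, false), (1, 2, true), (2, 0, false), (2, 0, true), (2, 1, false), (2, 1, true)]

theorem mem_letters {l : Letter} : l ∈ letters ↔ l.1 ≠ l.2.1 := by
  revert l; decide

theorem steinbergSymmGenSet_eq :
    steinbergSymmGenSet 3 = ⟨letters.map letterEval, by
      rw [Multiset.coe_nodup]
      exact List.Nodup.map_on (fun x hx y hy h =>
        letterEval_injOn (mem_letters.1 hx) (mem_letters.1 hy) h) (by decide)⟩ := by
  ext g
  simp [mem_steinbergSymmGenSet, mem_letters]

theorem card_steinbergSymmGenSet : (steinbergSymmGenSet 3).card = 12 := by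
  rw [steinbergSymmGenSet_eq]; rfl

theorem sum_steinbergSymmGenSet {M : Type*} [AddCommMonoid M] (f : SteinbergGroup 3 → M) :
    ∑ s ∈ steinbergSymmGenSet 3, f s = (letters.map fun l => f (letterEval l)).sum := by
  rw [steinbergSymmGenSet_eq]
  simp [Finset.sum, Function.comp_def]

end GeneratingSet

/-! ### Words and their simplification -/

section Words

/-- Words in the letters `x_ij^{±1}`. -/
abbrev Word : Type := List Letter

/-- The element of `St_3(ℤ)` that a word stands for. -/
noncomputable def wordEval (w : Word) : SteinbergGroup 3 := (w.map letterEval).prod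

/-- The inverse word. -/
def wordInv (w : Word) : Word := (w.map letterInv).reverse

theorem wordEval_nil : wordEval [] = 1 := rfl

theorem wordEval_cons (l : Letter) (w : Word) :
    wordEval (l :: w) = letterEval l * wordEval w := by
  simp [wordEval]

theorem wordEval_append (v w : Word) : wordEval (v ++ w) = wordEval v * wordEval w := by
  simp [wordEval]

theorem wordEval_inv (w : Word) : wordEval (wordInv w) = (wordEval w)⁻¹ := by
  simp [wordEval, wordInv, List.prod_inv_reverse, Function.comp_def, letterEval_inv]

theorem SteinbergSymm.aut_wordEval (σ : SteinbergSymm) (w : Word) :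
    σ.aut (wordEval w) = wordEval (w.map σ.act) := by
  simp [wordEval, map_list_prod, Function.comp_def, aut_letterEval]

/-- The letter `c` with `[a, b] = c`, for two letters `a`, `b` whose roots add up to a root. -/
def letterCommutator (a b : Letter) : Option Letter :=
  if a.1 = a.2.1 ∨ b.1 = b.2.1 then none
  else if a.2.1 = b.1 ∧ a.1 ≠ b.2.1 then some (a.1, b.2.1, xor a.2.2 b.2.2)
  else if a.1 = b.2.1 ∧ a.2.1 ≠ b.1 then some (b.1, a.2.1, !(xor a.2.2 b.2.2))
  else none

theorem letterCommutator_spec {a b c : Letter} (h : letterCommutator a b = some c) :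
    letterEval a * letterEval b = letterEval c * letterEval b * letterEval a ∧
      Commute (letterEval a) (letterEval c) ∧ Commute (letterEval b) (letterEval c) := by
  obtain ⟨i, j, a⟩ := a
  obtain ⟨k, l, b⟩ := b
  simp only [letterCommutator] at h
  split_ifs at h with h0 h1 h2
  · obtain ⟨rfl, hil⟩ := h1
    push Not at h0
    cases h
    refine ⟨?_, letterEval_commute hil h0.1.symm, letterEval_commute h0.2 (Ne.symm hil)⟩
    rw [← letterEval_commutator h0.1 h0.2 hil, commutatorElement_def]
    group
  · obtain ⟨rfl, hjk⟩ := h2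
    push Not at h0
    cases h
    refine ⟨?_, letterEval_commute h0.1 hjk, letterEval_commute (Ne.symm hjk) h0.2.symm⟩
    have h3 := letterEval_commutator h0.2 h0.1 (Ne.symm hjk) b a
    have h4 : letterEval (k, j, !(a ^^ b)) = (letterEval (k, j, b ^^ a))⁻¹ := by
      rw [← letterEval_inv, letterInv, Bool.xor_comm]
    rw [h4, ← h3, commutatorElement_def]
    group

/-- The lexicographic position of a letter. -/
def letterRank (l : Letter) : ℕ := l.1.val * 6 + l.2.1.val * 2 + l.2.2.toNat

/-- Left multiplication of a word by a letter followed by simplification: cancellation, sorting of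
commuting letters, the rules `a b a⁻¹ = c b` and `a b c⁻¹ = b a` for `[a, b] = c`, and
`a b d = c a b` for `[b, d] = c`, `[a, c] = d⁻¹`. The first argument bounds the recursion depth. -/
def push : ℕ → Letter → Word → Word
  | 0, a, w => a :: w
  | _ + 1, a, [] => [a]
  | n + 1, a, b :: r =>
    if b = letterInv a then r
    else if a.2.1 ≠ b.1 ∧ a.1 ≠ b.2.1 then
      if letterRank b < letterRank a then push n b (push n a r) else a :: b :: r
    else match r with
      | [] => [a, b]
      | d :: s =>
        match letterCommutator a b with
        | some c =>
          if d = letterInv a then push n c (push n b s)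
          else if d = letterInv c then push n b (push n a s)
          else a :: b :: d :: s
        | none =>
          match letterCommutator b d with
          | none => a :: b :: d :: s
          | some c =>
            if letterCommutator a c = some (letterInv d) then push n c (push n a (push n b s))
            else a :: b :: d :: s

theorem wordEval_push (n : ℕ) (a : Letter) (w : Word) :
    wordEval (push n a w) = letterEval a * wordEval w := by
  induction n generalizing a w with
  | zero => rw [push, wordEval_cons]
  | succ n ih =>
    cases w with
    | nil => rw [push, wordEval_cons]
    | cons b r =>
      rw [push.eq_def]
      dsimp only
      split_ifs with h1 h2 h3
      · rw [h1, wordEval_cons, letterEval_inv, mul_inv_cancel_left]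
      · rw [ih, ih, wordEval_cons, ← mul_assoc, ← mul_assoc,
          (letterEval_commute h2.2 h2.1).eq]
      · simp only [wordEval_cons]
      · cases r with
        | nil => simp only [wordEval_cons]
        | cons d s =>
          dsimp only
          split
          · rename_i c hc
            obtain ⟨hab, hac, hbc⟩ := letterCommutator_spec hc
            split_ifs with h4 h5
            · rw [ih, ih, h4]
              simp only [wordEval_cons, letterEval_inv, ← mul_assoc]
              rw [hab, mul_inv_cancel_right]
            · rw [ih, ih, h5]
              simp only [wordEval_cons, letterEval_inv, ← mul_assoc]
              rw [hab, mul_assoc _ _ (letterEval a), ((hbc.mul_left hac).symm).eq,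
                mul_inv_cancel_right]
            · simp only [wordEval_cons]
          · split
            · simp only [wordEval_cons]
            · rename_i c hc
              obtain ⟨hbd, hbc, hdc⟩ := letterCommutator_spec hc
              split_ifs with h4
              · obtain ⟨hac, had, hcd⟩ := letterCommutator_spec h4
                rw [letterEval_inv] at hac had hcd
                have had' := had.inv_right
                have hcd' := hcd.inv_right
                rw [inv_inv] at had' hcd'
                rw [ih, ih, ih]
                simp only [wordEval_cons, ← mul_assoc]
                congr 1
                have hca : letterEval c * letterEval a * letterEval d =
                    letterEval d * (letterEval c * letterEval a) := (hcd'.mul_left had').eq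
                calc letterEval c * letterEval a * letterEval b
                    = (letterEval d)⁻¹ * (letterEval c * letterEval a * letterEval d)
                        * letterEval b := by rw [hca, inv_mul_cancel_left]
                  _ = (letterEval d)⁻¹ * letterEval c * letterEval a * letterEval d
                        * letterEval b := by simp only [mul_assoc]
                  _ = letterEval a * letterEval c * letterEval d * letterEval b := by rw [← hac]
                  _ = letterEval a * (letterEval c * letterEval d * letterEval b) := by
                      simp only [mul_assoc]
                  _ = letterEval a * letterEval b * letterEval d := by rw [← hbd, mul_assoc]
              · simp only [wordEval_cons]

/-- A simplified word with the same value. It need not be a normal form for the word problem: two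
words for the same element may be simplified differently. -/
def simplifyWord (w : Word) : Word := w.foldr (push 12) []

theorem wordEval_simplifyWord (w : Word) : wordEval (simplifyWord w) = wordEval w := by
  induction w with
  | nil => rfl
  | cons a w ih => rw [wordEval_cons, ← ih, ← wordEval_push 12]; rfl

end Words

/-! ### The certificate -/

section CertificateData

/-- The six permutations of the indices, each given with its inverse. -/
def symmPerms : List (Equiv.Perm (Fin 3)) :=
  [⟨![0, 1, 2], ![0, 1, 2], by decide, by decide⟩,
    ⟨![0, 2, 1], ![0, 2, 1], by decide, by decide⟩,
    ⟨![1, 0, 2], ![1, 0, 2], by decide, by decide⟩,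
    ⟨![1, 2, 0], ![2, 0, 1], by decide, by decide⟩,
    ⟨![2, 0, 1], ![1, 2, 0], by decide, by decide⟩,
    ⟨![2, 1, 0], ![2, 1, 0], by decide, by decide⟩]

/-- The 48 symmetries, the one for `n < 96` depending on `n / 2` only. The digit `n / 4 % 4` selects
the index whose sign is changed, with `0` for none; changing two signs amounts to changing the
third. -/
def symmOfIndex (n : ℕ) : SteinbergSymm where
  perm := symmPerms.getD (n / 16) 1
  sign i := i.val + n / 4 % 4 == 3
  flip := n / 2 % 2 == 1

/-- The image of a word under the symmetry `symmOfIndex n`, inverted if `n` is odd. -/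
def symmWord (n : ℕ) (w : Word) : Word :=
  bif n % 2 == 1 then wordInv (w.map (symmOfIndex n).act) else w.map (symmOfIndex n).act

/-- Representatives for the orbits of the sign changes and the inverse transpose on `1`, the
generators, and the products `x_α^{±1} x_β^{±1}` with `α ≠ ±β`. -/
def baseWords : List Word :=
  [[],
    [(0, 1, false)],
    [(0, 2, false)],
    [(1, 2, false)],
    [(0, 1, false), (0, 2, false)],
    [(0, 1, false), (2, 1, false)],
    [(0, 2, false), (1, 2, false)],
    [(0, 1, false), (1, 2, false)],
    [(0, 1, false), (2, 0, false)],
    [(0, 2, false), (1, 0, false)],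
    [(0, 2, false), (2, 1, false)],
    [(1, 2, false), (0, 1, false)],
    [(1, 2, false), (2, 0, false)]]

/-- Representatives for the classes of words up to symmetries, inversion and simplification. The
representative with index `0` is the empty word. -/
def classWords : List Word :=
  [[],
    [(0, 1, false)],
    [(0, 1, false), (0, 1, false)],
    [(0, 1, false), (0, 2, false)],
    [(0, 1, false), (1, 0, false)],
    [(0, 1, false), (1, 0, true)],
    [(0, 1, false), (1, 2, false)],
    [(0, 1, false), (0, 1, false), (0, 2, false)],
    [(0, 1, false), (0, 1, false), (2, 0, false)],
    [(0, 1, false), (0, 2, false), (1, 2, false)],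
    [(0, 1, false), (1, 0, false), (0, 2, false)],
    [(0, 1, false), (1, 0, false), (1, 2, false)],
    [(0, 1, false), (1, 0, true), (2, 0, false)],
    [(0, 1, false), (2, 0, false), (0, 1, false)],
    [(0, 1, false), (2, 0, false), (0, 2, true)],
    [(0, 1, false), (2, 0, false), (1, 2, false)],
    [(0, 1, false), (2, 0, false), (1, 2, true)],
    [(0, 1, false), (0, 1, false), (0, 2, false), (0, 2, false)],
    [(0, 1, false), (0, 1, false), (0, 2, false), (1, 2, false)],
    [(0, 1, false), (0, 1, false), (0, 2, false), (2, 0, false)],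
    [(0, 1, false), (0, 1, false), (0, 2, false), (2, 0, true)],
    [(0, 1, false), (0, 1, false), (0, 2, false), (2, 1, false)],
    [(0, 1, false), (0, 1, false), (1, 2, false), (2, 1, true)],
    [(0, 1, false), (0, 2, false), (1, 0, false), (0, 2, false)],
    [(0, 1, false), (0, 2, false), (1, 0, false), (2, 0, false)],
    [(0, 1, false), (0, 2, false), (1, 0, false), (2, 0, true)],
    [(0, 1, false), (0, 2, false), (1, 0, false), (2, 1, false)],
    [(0, 1, false), (0, 2, false), (1, 0, false), (2, 1, true)],
    [(0, 1, false), (0, 2, false), (1, 0, true), (1, 2, false)],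
    [(0, 1, false), (0, 2, false), (1, 0, true), (2, 0, true)],
    [(0, 1, false), (0, 2, false), (1, 2, false), (2, 0, false)],
    [(0, 1, false), (0, 2, false), (1, 2, false), (2, 0, true)],
    [(0, 1, false), (0, 2, false), (1, 2, false), (2, 1, false)],
    [(0, 1, false), (0, 2, false), (1, 2, false), (2, 1, true)],
    [(0, 1, false), (1, 0, false), (0, 2, false), (2, 0, true)],
    [(0, 1, false), (1, 0, false), (1, 2, false), (2, 1, false)],
    [(0, 1, false), (1, 0, false), (1, 2, false), (2, 1, true)],
    [(0, 1, false), (1, 0, true), (1, 2, false), (2, 1, true)],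
    [(0, 1, false), (1, 2, false), (0, 1, false), (1, 2, false)],
    [(0, 1, false), (1, 2, false), (0, 1, false), (2, 0, false)],
    [(0, 1, false), (1, 2, false), (0, 1, false), (2, 0, true)],
    [(0, 1, false), (1, 2, false), (1, 2, false), (0, 1, false)],
    [(0, 1, false), (1, 2, false), (1, 2, false), (0, 1, true)],
    [(0, 1, false), (1, 2, false), (1, 2, false), (2, 0, false)],
    [(0, 1, false), (1, 2, false), (1, 2, false), (2, 0, true)],
    [(0, 1, false), (1, 2, false), (2, 0, false), (0, 1, false)],
    [(0, 1, false), (1, 2, false), (2, 0, false), (0, 1, true)],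
    [(0, 1, false), (1, 2, false), (2, 0, false), (0, 2, true)],
    [(0, 1, false), (1, 2, false), (2, 0, true), (0, 1, false)],
    [(0, 1, false), (1, 2, false), (2, 0, true), (0, 2, false)],
    [(0, 1, false), (1, 2, false), (2, 0, true), (2, 1, true)],
    [(0, 1, false), (1, 2, false), (2, 1, false), (0, 2, false)],
    [(0, 1, false), (1, 2, false), (2, 1, false), (1, 0, false)],
    [(0, 1, false), (1, 2, false), (2, 1, false), (1, 0, true)]]

/-- The squares of the certificate. A block consists of a sign vector `χ`, which selects a joint
eigenspace of the two sign changes and the inverse transpose, and of rows of coefficients on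
`baseWords`. The rows are `40000` times the rows of a Cholesky factor of a numerically optimized Gram
matrix, rounded to integers; for trivial `χ` the coefficient of the empty word makes the
row sum vanish, while for the other `χ` the projection kills the unit. -/
def certificateBlocks : List ((ℤ × ℤ × ℤ) × List (List ℤ)) :=
  [((1, 1, 1), [
    [-28967, -995, 61540, -995, -17295, 19957, -17295, 5427, 5014, -18416, -18416, 5427, 5014],
    [-29439, -1011, 0, 61532, 19679, -16975, -17577, 5103, 5509, 5130, 4717, -18331, -18337],
    [-29927, 61524, 0, 0, -17256, -17256, 19393, -18249, -18249, 4802, 5208, 4802, 5208],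
    [0, 0, 0, 0, 7451, -1804, -5650, -25223, 37506, -13094, -7610, -7610, 16034],
    [1, 0, 0, 0, -4227, 7235, -3013, -18598, 0, 13661, -9348, 36726, -22437],
    [0, 0, 0, 0, -1421, -4449, 5864, 6633, 0, -25846, 35517, 0, -16298],
    [-4, 0, 0, 0, 25220, -12602, -12602, 2025, 0, 15782, 0, 0, -17819],
    [-5, 0, 0, 0, 0, 21845, -21819, 19388, 0, -11467, 0, 0, -7942],
    [-196, 0, 0, 0, 0, 0, 1066, -792, 0, -233, 0, 0, 155],
    [-57, 0, 0, 0, 0, 0, 0, -59, 0, -59, 0, 0, 175],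
    [-80, 0, 0, 0, 0, 0, 0, 164, 0, -84, 0, 0, 0],
    [-141, 0, 0, 0, 0, 0, 0, 0, 0, 141, 0, 0, 0]]),
  ((1, 1, -1), [
    [0, 77579, 2384, -2384, -24927, -24927, 0, -19101, -19101, -3664, 4197, 3664, -4197],
    [0, 0, 77543, 2458, -24172, 766, -24939, 4786, -3078, -18997, -19239, 4086, -3536],
    [0, 0, 0, 77504, 0, 24160, -24160, 2928, -4691, 4691, -2928, -19137, -19137],
    [0, 0, 0, 0, -14735, -1750, -2855, -14348, 21999, 16338, -21999, 37398, -30645],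
    [0, 0, 0, 0, -9214, 1168, -17142, 34537, -24045, -17034, 8553, 0, 11090],
    [0, 0, 0, 0, -12138, -20667, 5145, 0, -4589, -22095, 29010, 0, -8011],
    [0, 0, 0, 0, -6328, 7602, -12685, 0, -17757, 18798, 0, 0, -16498],
    [0, 0, 0, 0, -253, 427, 253, 0, -113, 0, 0, 0, 113],
    [0, 0, 0, 0, -82, 0, 202, 0, 396, 0, 0, 0, 203],
    [0, 0, 0, 0, 284, 0, -216, 0, 0, 0, 0, 0, 340],
    [0, 0, 0, 0, 72, 0, -36, 0, 0, 0, 0, 0, 0],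
    [0, 0, 0, 0, 0, 0, 62, 0, 0, 0, 0, 0, 0]]),
  ((-1, -1, 1), [
    [0, 127450, 0, 0, -44730, -44730, 0, -34275, -34275, 5186, 32491, -5186, -32491],
    [0, 0, 0, 0, 5259, -1955, 14781, 64885, -55546, -14298, 2275, -28003, 17340],
    [0, 0, 0, 0, -18291, 26175, 13058, 0, 22276, 45915, -11188, 13223, 24748],
    [0, 0, 0, 0, -33177, 29435, 40564, 0, -10574, 0, -1989, 15518, -19047],
    [0, 0, 0, 0, -9760, 1710, 0, 0, -22726, 0, 33906, 33355, -2769],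
    [0, 0, 0, 0, 881, -699, 0, 0, 137, 0, 0, -305, 439],
    [0, 0, 0, 0, 0, -412, 0, 0, 484, 0, 0, -327, -274],
    [0, 0, 0, 0, 0, 5, 0, 0, 0, 0, 0, 270, 204],
    [0, 0, 0, 0, 0, 87, 0, 0, 0, 0, 0, 0, -4],
    [0, 0, 0, 0, 0, 0, 0, 0, 0, 0, 0, 0, 86]]),
  ((-1, -1, -1), [
    [0, 147849, 0, 0, -44167, -44167, -24459, -38727, -38727, 1438, 29547, 1438, 29547],
    [0, 0, 0, 0, 2629, 9287, -215, 62331, -50913, 1590, 2860, -25406, -15400],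
    [0, 0, 0, 0, -11909, -24350, 8769, 0, -31096, 48321, 6844, 21083, 17310],
    [0, 0, 0, 0, 38214, -25994, -6236, 0, 8961, 0, -3209, -22086, 734],
    [0, 0, 0, 0, 0, -4325, -25255, 0, -15300, 0, 37433, 17885, 10798],
    [0, 0, 0, 0, 0, 15215, -26092, 0, 3197, 0, 0, -20973, 28506],
    [0, 0, 0, 0, 0, 1989, -1079, 0, -1177, 0, 0, 189, 0],
    [0, 0, 0, 0, 0, 0, 310, 0, -100, 0, 0, -39, 0],
    [0, 0, 0, 0, 0, 0, 0, 0, -78, 0, 0, 121, 0],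
    [0, 0, 0, 0, 0, 0, 0, 0, 34, 0, 0, 0, 0]])]

/-- For each term of `certificateTerms` a number `96 * c + n`: the symmetry with index `n` takes the
word to one that simplifies to the representative of class `c`. -/
def classHints : List ℕ := [
    0, 96, 97, 112, 113, 99, 98, 160, 161, 115, 114, 163, 162, 96, 192, 0, 288, 292, 384, 480,
    576, 580, 622, 618, 323, 327, 97, 0, 193, 293, 289, 483, 392, 588, 584, 614, 610, 326, 322,
    112, 288, 293, 208, 0, 621, 613, 339, 347, 400, 496, 592, 600, 113, 292, 289, 0, 209, 617,
    609, 346, 338, 499, 404, 604, 596, 99, 393, 481, 608, 612, 195, 0, 320, 324, 291, 295, 586,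
    590, 98, 482, 385, 616, 620, 0, 194, 325, 321, 294, 290, 582, 578, 160, 585, 581, 339, 346,
    320, 325, 256, 0, 595, 607, 448, 544, 161, 589, 577, 347, 338, 324, 321, 0, 257, 603, 599,
    547, 452, 115, 611, 619, 405, 497, 291, 294, 598, 606, 211, 0, 336, 344, 114, 615, 623, 498,
    401, 295, 290, 602, 594, 0, 210, 345, 337, 163, 323, 326, 597, 601, 579, 591, 453, 545, 336,
    345, 259, 0, 162, 327, 322, 605, 593, 583, 587, 546, 449, 344, 337, 0, 258, 0, 96, 97, 112,
    113, 99, 98, 160, 161, 115, 114, 163, 162, 0, 0, 0, 0, 0, 0, 0, 0, 96, 98, 97, 99, 97, 99,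
    96, 98, 112, 114, 112, 114, 113, 115, 113, 115, 160, 162, 161, 163, 160, 162, 161, 163, 288,
    290, 293, 295, 289, 291, 292, 294, 323, 321, 322, 320, 326, 324, 327, 325, 339, 337, 347,
    345, 346, 344, 338, 336, 576, 578, 584, 586, 588, 590, 580, 582, 622, 620, 614, 612, 610,
    608, 618, 616, 621, 623, 613, 615, 609, 611, 617, 619, 592, 594, 600, 602, 604, 606, 596,
    598, 585, 587, 577, 579, 581, 583, 589, 591, 595, 593, 603, 601, 607, 605, 599, 597, 97, 97,
    97, 97, 97, 97, 97, 97, 0, 392, 193, 483, 193, 483, 0, 392, 293, 610, 293, 610, 289, 614,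
    289, 614, 588, 322, 584, 326, 588, 322, 584, 326, 112, 1090, 677, 1164, 673, 1160, 113, 1094,
    163, 1064, 706, 1190, 710, 1186, 162, 1068, 581, 898, 872, 636, 876, 632, 577, 902, 160, 994,
    802, 1362, 806, 1366, 161, 998, 115, 972, 776, 1369, 780, 1373, 114, 968, 1155, 1249, 1093,
    337, 1089, 336, 1159, 1253, 597, 1548, 888, 1452, 892, 1448, 593, 1544, 346, 1067, 1282,
    1193, 1286, 1197, 347, 1071, 1478, 881, 1570, 655, 1574, 651, 1474, 885, 113, 113, 113, 113,
    113, 113, 113, 113, 292, 609, 289, 617, 289, 617, 292, 609, 0, 404, 0, 404, 209, 499, 209,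
    499, 346, 596, 338, 604, 346, 596, 338, 604, 96, 1106, 97, 1114, 689, 1172, 692, 1180, 601,
    897, 593, 905, 892, 612, 884, 620, 160, 1076, 161, 1084, 730, 1202, 722, 1210, 585, 1564,
    577, 1556, 876, 1460, 868, 1468, 1171, 1265, 1179, 1268, 1105, 320, 1113, 321, 99, 988, 98,
    980, 796, 1357, 788, 1349, 163, 1010, 162, 1018, 826, 1354, 818, 1346, 873, 1473, 865, 1481,
    671, 1581, 663, 1573, 1205, 1298, 1213, 1306, 1087, 327, 1079, 326, 161, 161, 161, 161, 161,
    161, 161, 161, 589, 321, 577, 324, 577, 324, 589, 321, 347, 599, 347, 599, 338, 603, 338,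
    603, 0, 452, 257, 547, 0, 452, 257, 547, 877, 594, 584, 887, 865, 606, 580, 891, 1220, 737,
    1138, 99, 1224, 740, 1150, 98, 112, 1124, 763, 1234, 113, 1128, 754, 1246, 288, 1137, 1313,
    1219, 289, 1149, 1316, 1231, 1555, 609, 1467, 900, 1567, 621, 1463, 904, 909, 1441, 635,
    1545, 897, 1453, 631, 1541, 1237, 1330, 1131, 295, 1241, 1339, 1127, 294, 96, 1032, 840,
    1385, 97, 1028, 836, 1381, 115, 1042, 862, 1390, 114, 1054, 850, 1378, 289, 289, 289, 289,
    289, 289, 289, 289, 113, 1089, 673, 1159, 673, 1159, 113, 1089, 97, 1105, 97, 1105, 689,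
    1179, 689, 1179, 876, 593, 577, 892, 876, 593, 577, 892, 0, 2316, 193, 2423, 1633, 2787, 209,
    2411, 604, 993, 881, 2700, 2028, 1369, 596, 972, 588, 1009, 584, 988, 2044, 1349, 865, 2716,
    346, 2604, 1282, 3292, 1740, 4866, 338, 2508, 499, 2220, 1932, 3250, 1836, 1190, 404, 1064,
    483, 2236, 392, 1076, 1852, 1210, 1948, 3234, 326, 2620, 322, 2524, 1756, 4877, 1298, 3276,
    730, 1620, 811, 3004, 806, 1524, 161, 2908, 2988, 823, 1512, 826, 2892, 162, 1608, 710, 322,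
    322, 322, 322, 322, 322, 322, 322, 162, 1067, 706, 1197, 706, 1197, 162, 1067, 600, 898, 600,
    898, 881, 619, 881, 619, 1221, 738, 1147, 97, 1221, 738, 1147, 97, 605, 994, 888, 2695, 2017,
    1366, 593, 971, 0, 2337, 1666, 2818, 193, 2466, 258, 2434, 1391, 2082, 1051, 610, 2754, 907,
    1026, 614, 546, 2242, 1858, 1164, 1954, 3224, 449, 1094, 344, 2530, 1256, 3330, 1762, 4824,
    337, 2626, 1502, 780, 1598, 753, 2946, 115, 3042, 773, 112, 2914, 861, 3010, 673, 1558, 852,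
    1462, 1236, 1890, 2274, 483, 3192, 1986, 1134, 392, 4819, 1794, 2658, 289, 3298, 1336, 2562,
    293, 338, 338, 338, 338, 338, 338, 338, 338, 580, 897, 865, 631, 865, 631, 580, 897, 161,
    1079, 161, 1079, 722, 1213, 722, 1213, 113, 1127, 754, 1241, 113, 1127, 754, 1241, 589, 1010,
    577, 983, 2033, 1354, 868, 2715, 1390, 2081, 1042, 617, 2767, 900, 1031, 609, 0, 2353, 257,
    2450, 209, 2482, 1682, 2834, 96, 2930, 840, 1450, 689, 1546, 845, 3026, 1486, 796, 3058, 793,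
    2962, 99, 1582, 737, 324, 2546, 321, 2642, 1778, 4804, 1268, 3346, 547, 2258, 452, 1114,
    1970, 3204, 1874, 1180, 292, 2578, 1810, 4803, 289, 2674, 1316, 3314, 499, 2290, 2002, 3172,
    404, 1150, 1906, 1224, 577, 577, 577, 577, 577, 577, 577, 577, 161, 993, 811, 1369, 811,
    1369, 161, 993, 584, 1567, 584, 1567, 865, 1467, 865, 1467, 289, 1138, 1313, 1224, 289, 1138,
    1313, 1224, 347, 2607, 1291, 3287, 1729, 4877, 338, 2507, 547, 2241, 1867, 1159, 1967, 3223,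
    452, 1089, 97, 2929, 833, 1441, 689, 1541, 840, 3029, 0, 5073, 4018, 4772, 4114, 4583, 257,
    5170, 603, 4978, 4277, 2167, 4177, 483, 599, 4955, 1186, 3887, 1064, 1124, 3154, 1246, 3250,
    3787, 1378, 4385, 1035, 4498, 2767, 4685, 1042, 4485, 113, 3371, 3649, 3555, 673, 3538, 763,
    3471, 1179, 3089, 3922, 1241, 1105, 1131, 3826, 3189, 623, 623, 623, 623, 623, 623, 623, 623,
    114, 975, 769, 1362, 769, 1362, 114, 975, 1170, 1266, 1170, 1266, 1116, 326, 1116, 326, 1554,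
    610, 1458, 911, 1554, 610, 1458, 911, 498, 2223, 1925, 3257, 1825, 1193, 401, 1071, 345,
    2529, 1249, 3337, 1775, 4823, 337, 2629, 1487, 799, 3067, 786, 2975, 97, 1579, 742, 602,
    4977, 4284, 2172, 4188, 483, 594, 4956, 0, 5052, 4085, 4530, 3985, 4725, 210, 5147, 3597,
    3695, 3493, 721, 3393, 163, 3516, 710, 1203, 3900, 3243, 3804, 3151, 1217, 1073, 1151, 1082,
    1090, 3745, 3228, 3845, 1164, 1204, 3132, 4476, 977, 4443, 1020, 4351, 1356, 4631, 2709, 620,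
    620, 620, 620, 620, 620, 620, 620, 1154, 1250, 1100, 346, 1100, 346, 1154, 1250, 98, 991, 98,
    991, 785, 1346, 785, 1346, 908, 1442, 626, 1538, 908, 1442, 626, 1538, 482, 2239, 385, 1087,
    1841, 1205, 1945, 3237, 1503, 783, 1591, 762, 2959, 113, 3047, 770, 325, 2545, 321, 2649,
    1791, 4811, 1265, 3349, 1187, 3884, 1057, 1135, 3167, 1233, 3255, 3788, 3596, 3692, 3500,
    730, 3404, 160, 3513, 705, 0, 5036, 194, 5127, 3969, 4710, 4073, 4514, 582, 4961, 578, 4940,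
    4172, 499, 4268, 2156, 2697, 4619, 961, 4460, 1004, 4423, 1372, 4335, 3212, 3761, 1180, 3865,
    3116, 1192, 1106, 1062, 593, 593, 593, 593, 593, 593, 593, 593, 596, 1551, 881, 1447, 881,
    1447, 596, 1551, 162, 1009, 162, 1009, 823, 1349, 823, 1349, 1236, 1329, 1122, 289, 1236,
    1329, 1122, 289, 327, 2623, 322, 2519, 1745, 4866, 1303, 3275, 113, 2913, 852, 3017, 673,
    1561, 849, 1457, 546, 2257, 449, 1105, 1983, 3211, 1879, 1179, 1379, 4386, 1026, 4505, 2754,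
    4674, 1047, 4482, 1202, 3903, 3234, 3799, 3138, 1230, 1076, 1144, 583, 4962, 587, 4935, 4161,
    499, 4265, 2155, 0, 5057, 258, 5154, 4098, 4596, 4002, 4792, 3177, 3810, 3073, 1159, 1221,
    3906, 1143, 1089, 3571, 3665, 3522, 689, 3487, 743, 3383, 97, 584, 584, 584, 584, 584, 584,
    584, 584, 347, 1064, 1282, 1186, 1282, 1186, 347, 1064, 872, 1474, 872, 1474, 658, 1570, 658,
    1570, 97, 1035, 833, 1378, 97, 1035, 833, 1378, 731, 1623, 802, 2999, 811, 1531, 161, 2907,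
    1237, 1889, 2283, 483, 3189, 1997, 1131, 392, 293, 2577, 1819, 4808, 289, 2685, 1313, 3317,
    112, 3368, 3656, 3560, 673, 3549, 763, 3464, 1083, 1089, 3752, 3223, 3848, 1155, 1201, 3131,
    2696, 4616, 968, 4455, 993, 4424, 1369, 4328, 3176, 3809, 3080, 1164, 1224, 3917, 1138, 1094,
    0, 5000, 3937, 4742, 193, 5095, 4040, 4546, 614, 4913, 4136, 547, 610, 4904, 4232, 2120, 594,
    594, 594, 594, 594, 594, 594, 594, 1479, 882, 1579, 644, 1579, 644, 1479, 882, 1204, 1297,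
    1204, 1297, 1074, 321, 1074, 321, 114, 1041, 855, 1381, 114, 1041, 855, 1381, 2989, 820,
    1505, 817, 2881, 161, 1613, 705, 4818, 1793, 2667, 295, 3311, 1335, 2567, 290, 498, 2289,
    2011, 3183, 401, 1137, 1911, 1231, 1178, 3090, 3931, 1234, 1116, 1124, 3831, 3186, 4477, 978,
    4434, 1015, 4338, 1347, 4626, 2706, 3213, 3762, 1173, 3858, 3105, 1191, 1111, 1057, 3570,
    3666, 3531, 695, 3474, 737, 3378, 98, 615, 4914, 4129, 547, 623, 4903, 4237, 2127, 0, 5009,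
    4050, 4564, 210, 5106, 3954, 4763]

/-- The Laplacian as a formal sum. -/
def laplacianTerms : List (ℤ × Word) := (12, []) :: letters.map fun l => (-1, [l])

/-- Conjugation by the diagonal matrix with entry `-1` at `i` and `1` elsewhere. -/
def signFlip (i : Fin 3) : SteinbergSymm := ⟨1, fun j => j == i, false⟩

/-- The inverse transpose, `x_ij ↦ x_ji⁻¹`. -/
def transposeInv : SteinbergSymm := ⟨1, fun _ => false, true⟩

/-- The elements of the group generated by two sign changes and the inverse transpose. -/
def boolTriples : List (Bool × Bool × Bool) :=
  [(false, false, false), (false, false, true), (false, true, false), (false, true, true),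
    (true, false, false), (true, false, true), (true, true, false), (true, true, true)]

/-- The image of a word under the composite of the involutions selected by `b`. -/
def orbitWord (b : Bool × Bool × Bool) (w : Word) : Word :=
  let w₁ := bif b.2.2 then w.map transposeInv.act else w
  let w₂ := bif b.2.1 then w₁.map (signFlip 1).act else w₁
  bif b.1 then w₂.map (signFlip 0).act else w₂

/-- The value of the character with signs `χ` at the element `b`. -/
def orbitSign (χ : ℤ × ℤ × ℤ) (b : Bool × Bool × Bool) : ℤ :=
  (bif b.1 then χ.1 else 1) * ((bif b.2.1 then χ.2.1 else 1) * (bif b.2.2 then χ.2.2 else 1))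

/-- An entry of the Gram matrix `Rᵀ R` of the matrix `R` with the given rows. -/
def gramEntry (rows : List (List ℤ)) (k l : ℕ) : ℤ :=
  (rows.map fun r => r.getD k 0 * r.getD l 0).sum

/-- The formal sum `∑ a^* P_χ a` over the rows `a` of all blocks, with the coefficients of equal
word pairs collected through the Gram matrices. -/
def quadraticTerms (B : List ((ℤ × ℤ × ℤ) × List (List ℤ))) : List (ℤ × Word) :=
  (List.range 13).flatMap fun k => (List.range 13).flatMap fun l => boolTriples.map fun b =>
    ((B.map fun p => orbitSign p.1 b * gramEntry p.2 k l).sum,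
      wordInv (baseWords.getD k []) ++ orbitWord b (baseWords.getD l []))

/-- Scalar multiplication of formal sums. -/
def scaleTerms (z : ℤ) (T : List (ℤ × Word)) : List (ℤ × Word) := T.map fun p => (z * p.1, p.2)

/-- Multiplication of formal sums. -/
def mulTerms (S T : List (ℤ × Word)) : List (ℤ × Word) :=
  S.flatMap fun p => T.map fun q => (p.1 * q.1, p.2 ++ q.2)

/-- The formal sum `N (Δ² - (22 / 125) Δ) - ∑ a^* P_χ a` with `N = 40000²`. -/
def certificateTerms : List (ℤ × Word) :=
  scaleTerms 1600000000 (mulTerms laplacianTerms laplacianTerms) ++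
    (scaleTerms (-281600000) laplacianTerms ++ scaleTerms (-1) (quadraticTerms certificateBlocks))

/-- Whether the class number recorded in `p.2` is right for the word of `p`. -/
def checkClass (p : (ℤ × Word) × ℕ) : Bool :=
  Nat.blt (p.2 / 96) 54 &&
    decide (simplifyWord (symmWord (p.2 % 96) p.1.2) = classWords.getD (p.2 / 96) [])

/-- The total coefficient of class `c`. -/
def classCoeff (c : ℕ) (L : List ((ℤ × Word) × ℕ)) : ℤ :=
  L.foldr (fun p s => bif Nat.beq (p.2 / 96) c then p.1.1 + s else s) 0

/-- Whether the coefficients `f 0, …, f n` have sum zero and all but `f 0` are nonpositive. -/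
def checkCoeffs (n : ℕ) (f : ℕ → ℤ) : Bool :=
  decide ((((List.range n).map fun c => f (c + 1)).sum + f 0) = 0) &&
    (List.range n).all fun c => decide (f (c + 1) ≤ 0)

end CertificateData

/-! ### Formal sums of words -/

section FormalSums

/-- The value of a formal sum of words in the group ring. -/
noncomputable def evalTerms (T : List (ℤ × Word)) : MonoidAlgebra ℝ (SteinbergGroup 3) :=
  (T.map fun p => (p.1 : ℝ) • MonoidAlgebra.of ℝ _ (wordEval p.2)).sum

theorem evalTerms_append (S T : List (ℤ × Word)) :
    evalTerms (S ++ T) = evalTerms S + evalTerms T := by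
  simp [evalTerms]

theorem evalTerms_cons (p : ℤ × Word) (T : List (ℤ × Word)) :
    evalTerms (p :: T) = (p.1 : ℝ) • MonoidAlgebra.of ℝ _ (wordEval p.2) + evalTerms T := by
  simp only [evalTerms, List.map_cons, List.sum_cons]

theorem evalTerms_scale (z : ℤ) (T : List (ℤ × Word)) :
    evalTerms (scaleTerms z T) = (z : ℝ) • evalTerms T := by
  simp only [evalTerms, scaleTerms, List.map_map, Function.comp_def, List.smul_sum, smul_smul,
    Int.cast_mul]

theorem evalTerms_map_mul (p : ℤ × Word) (T : List (ℤ × Word)) :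
    evalTerms (T.map fun q => (p.1 * q.1, p.2 ++ q.2)) =
      ((p.1 : ℝ) • MonoidAlgebra.of ℝ _ (wordEval p.2)) * evalTerms T := by
  induction T with
  | nil => simp [evalTerms]
  | cons q T ih =>
    rw [List.map_cons, evalTerms_cons, evalTerms_cons, ih, mul_add, smul_mul_smul_comm,
      wordEval_append, map_mul, Int.cast_mul]

theorem evalTerms_mul (S T : List (ℤ × Word)) :
    evalTerms (mulTerms S T) = evalTerms S * evalTerms T := by
  induction S with
  | nil => simp [evalTerms, mulTerms]
  | cons p S ih =>
    rw [evalTerms_cons, add_mul, ← ih, ← evalTerms_map_mul, ← evalTerms_append]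
    rfl

theorem evalTerms_flatMap_range (n : ℕ) (f : ℕ → List (ℤ × Word)) :
    evalTerms ((List.range n).flatMap f) = ∑ k ∈ Finset.range n, evalTerms (f k) := by
  induction n with
  | zero => simp [evalTerms]
  | succ n ih =>
    rw [List.range_succ, List.flatMap_append, evalTerms_append, ih, Finset.sum_range_succ,
      List.flatMap_singleton]

theorem evalTerms_laplacianTerms :
    evalTerms laplacianTerms = groupLaplacian (steinbergSymmGenSet 3) := by
  rw [groupLaplacian, card_steinbergSymmGenSet, sum_steinbergSymmGenSet, laplacianTerms,
    evalTerms_cons, wordEval_nil, map_one, sub_eq_add_neg]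
  congr 1
  rw [evalTerms, List.map_map, ← neg_one_smul ℝ (List.sum _), List.smul_sum, List.map_map]
  refine congrArg List.sum (List.map_congr_left fun l _ => ?_)
  simp [wordEval]

end FormalSums

/-! ### Meaning of the certificate -/

section Certificate

/-- For a sign vector `χ`, eight times the projection of the group ring to the joint eigenspace of
the two sign changes and the inverse transpose. -/
noncomputable def eigenProj (χ : ℤ × ℤ × ℤ) :
    MonoidAlgebra ℝ (SteinbergGroup 3) →ₗ[ℝ] MonoidAlgebra ℝ (SteinbergGroup 3) :=
  twist χ.1 (signFlip 0).aut ∘ₗ twist χ.2.1 (signFlip 1).aut ∘ₗ twist χ.2.2 transposeInv.aut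

theorem signFlip_aut_mul_self (i : Fin 3) : (signFlip i).aut * (signFlip i).aut = 1 :=
  SteinbergSymm.aut_mul_self (by revert i; decide)

theorem transposeInv_aut_mul_self : transposeInv.aut * transposeInv.aut = 1 :=
  SteinbergSymm.aut_mul_self (by decide)

theorem signFlip_aut_comm (i j : Fin 3) :
    (signFlip i).aut * (signFlip j).aut = (signFlip j).aut * (signFlip i).aut :=
  SteinbergSymm.aut_mul_eq (by revert i j; decide)

theorem signFlip_transposeInv_aut_comm (i : Fin 3) :
    (signFlip i).aut * transposeInv.aut = transposeInv.aut * (signFlip i).aut :=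
  SteinbergSymm.aut_mul_eq (by revert i; decide)

theorem eigenProj_of (χ : ℤ × ℤ × ℤ) (w : Word) :
    eigenProj χ (MonoidAlgebra.of ℝ _ (wordEval w)) = (boolTriples.map fun b =>
      (orbitSign χ b : ℝ) • MonoidAlgebra.of ℝ _ (wordEval (orbitWord b w))).sum := by
  simp only [eigenProj, LinearMap.comp_apply, twist_apply, map_add, map_smul, groupRingAut_of,
    SteinbergSymm.aut_wordEval, boolTriples, List.map_cons, List.map_nil, List.sum_cons,
    List.sum_nil, orbitSign, orbitWord, cond_true, cond_false, Int.cast_mul, Int.cast_one]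
  module

/-- The group ring element with coefficients `r` on the base words. -/
noncomputable def rowElement (r : List ℤ) : MonoidAlgebra ℝ (SteinbergGroup 3) :=
  ∑ k ∈ Finset.range 13,
    ((r.getD k 0 : ℤ) : ℝ) • MonoidAlgebra.of ℝ _ (wordEval (baseWords.getD k []))

theorem sum_rowElement_star_mul
    (P : MonoidAlgebra ℝ (SteinbergGroup 3) →ₗ[ℝ] MonoidAlgebra ℝ (SteinbergGroup 3))
    (rows : List (List ℤ)) :
    (rows.map fun r => groupRingStar (rowElement r) * P (rowElement r)).sum =
      ∑ k ∈ Finset.range 13, ∑ l ∈ Finset.range 13, (gramEntry rows k l : ℝ) •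
        (MonoidAlgebra.of ℝ _ (wordEval (baseWords.getD k []))⁻¹ *
          P (MonoidAlgebra.of ℝ _ (wordEval (baseWords.getD l [])))) := by
  induction rows with
  | nil => simp [gramEntry]
  | cons r rows ih =>
    rw [List.map_cons, List.sum_cons, ih]
    simp only [gramEntry, List.map_cons, List.sum_cons, Int.cast_add, add_smul,
      Finset.sum_add_distrib]
    congr 1
    simp only [rowElement, groupRingStar_sum, groupRingStar_smul, groupRingStar_of, map_sum,
      map_smul, Finset.sum_mul, Finset.mul_sum, smul_mul_smul_comm, Int.cast_mul]
    exact Finset.sum_comm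

theorem evalTerms_quadraticTerms_eq_sum (B : List ((ℤ × ℤ × ℤ) × List (List ℤ))) :
    evalTerms (quadraticTerms B) = ∑ k ∈ Finset.range 13, ∑ l ∈ Finset.range 13,
      (boolTriples.map fun b =>
        (((B.map fun p => orbitSign p.1 b * gramEntry p.2 k l).sum : ℤ) : ℝ) •
          MonoidAlgebra.of ℝ _
            (wordEval (wordInv (baseWords.getD k []) ++ orbitWord b (baseWords.getD l [])))).sum :=
  by
  simp only [quadraticTerms, evalTerms_flatMap_range]
  simp only [evalTerms, List.map_map, Function.comp_def]

theorem evalTerms_quadraticTerms (B : List ((ℤ × ℤ × ℤ) × List (List ℤ))) :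
    evalTerms (quadraticTerms B) = (B.map fun p => (p.2.map fun r =>
      groupRingStar (rowElement r) * eigenProj p.1 (rowElement r)).sum).sum := by
  induction B with
  | nil => simp [evalTerms_quadraticTerms_eq_sum]
  | cons p B ih =>
    rw [List.map_cons, List.sum_cons, ← ih, evalTerms_quadraticTerms_eq_sum,
      evalTerms_quadraticTerms_eq_sum, sum_rowElement_star_mul]
    simp only [List.map_cons, List.sum_cons, Int.cast_add, add_smul, List.sum_map_add,
      Finset.sum_add_distrib]
    congr 1
    refine Finset.sum_congr rfl fun k _ => Finset.sum_congr rfl fun l _ => ?_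
    rw [eigenProj_of, ← List.sum_map_mul_left, List.smul_sum, List.map_map]
    refine congrArg List.sum (List.map_congr_left fun b _ => ?_)
    simp only [Function.comp_def, mul_smul_comm, ← map_mul, wordEval_append, wordEval_inv,
      smul_smul, Int.cast_mul, mul_comm]

variable [Fintype (autPreserving (steinbergSymmGenSet 3))]

theorem symmSum_symmWord (n : ℕ) (w : Word) :
    symmSum (autPreserving (steinbergSymmGenSet 3)) (MonoidAlgebra.of ℝ _ (wordEval (symmWord n w)))
      = symmSum (autPreserving (steinbergSymmGenSet 3)) (MonoidAlgebra.of ℝ _ (wordEval w)) := by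
  have h : ∀ σ : SteinbergSymm, symmSum (autPreserving (steinbergSymmGenSet 3))
      (MonoidAlgebra.of ℝ _ (wordEval (w.map σ.act))) =
      symmSum (autPreserving (steinbergSymmGenSet 3)) (MonoidAlgebra.of ℝ _ (wordEval w)) :=
    fun σ => by rw [← σ.aut_wordEval, symmSum_of_aut σ.aut_mem]
  rw [symmWord]
  cases n % 2 == 1
  · exact h _
  · rw [cond_true, wordEval_inv, symmSum_of_inv, h]

/-- The symmetrization of the representative of the `c`-th class of words. -/
noncomputable def classSum (c : ℕ) : MonoidAlgebra ℝ (SteinbergGroup 3) :=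
  symmSum (autPreserving (steinbergSymmGenSet 3))
    (MonoidAlgebra.of ℝ _ (wordEval (classWords.getD c [])))

theorem symmSum_of_checkClass {p : (ℤ × Word) × ℕ} (h : checkClass p = true) :
    p.2 / 96 < 54 ∧ symmSum (autPreserving (steinbergSymmGenSet 3))
      (MonoidAlgebra.of ℝ _ (wordEval p.1.2)) = classSum (p.2 / 96) := by
  rw [checkClass, Bool.and_eq_true, decide_eq_true_eq] at h
  refine ⟨by simpa using h.1, ?_⟩
  rw [classSum, ← h.2, wordEval_simplifyWord, symmSum_symmWord]

theorem symmSum_evalTerms_of_checkClass {L : List ((ℤ × Word) × ℕ)}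
    (h : L.all checkClass = true) :
    symmSum (autPreserving (steinbergSymmGenSet 3)) (evalTerms (L.map Prod.fst)) =
      ∑ c ∈ Finset.range 54, (classCoeff c L : ℝ) • classSum c := by
  induction L with
  | nil => simp [evalTerms, classCoeff]
  | cons p L ih =>
    rw [List.all_cons, Bool.and_eq_true] at h
    obtain ⟨hlt, hp⟩ := symmSum_of_checkClass h.1
    rw [List.map_cons, evalTerms_cons, map_add, map_smul, ih h.2, hp]
    have hc : ∀ c, (classCoeff c (p :: L) : ℝ) =
        (if p.2 / 96 = c then (p.1.1 : ℝ) else 0) + classCoeff c L := by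
      intro c
      rw [classCoeff, List.foldr_cons, ← classCoeff]
      by_cases hc : p.2 / 96 = c
      · simp [hc]
      · have : Nat.beq (p.2 / 96) c = false :=
          Bool.eq_false_iff.2 (mt Nat.eq_of_beq_eq_true hc)
        simp [hc, this]
    simp only [hc, add_smul, Finset.sum_add_distrib, ite_smul, zero_smul]
    rw [Finset.sum_ite_eq, if_pos (Finset.mem_range.2 hlt)]

/-- With `f 0 = -∑ f (c + 1)` the sum equals `∑ (-f (c + 1)) (classSum 0 - classSum (c + 1))`. -/
theorem isSumOfHermitianSquares_of_checkCoeffs {n : ℕ} {f : ℕ → ℤ}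
    (h : checkCoeffs n f = true) :
    IsSumOfHermitianSquares (∑ c ∈ Finset.range (n + 1), (f c : ℝ) • classSum c) := by
  simp only [checkCoeffs, Bool.and_eq_true, decide_eq_true_eq, List.all_eq_true,
    List.mem_range] at h
  obtain ⟨hsum, hle⟩ := h
  have hrange : ((List.range n).map fun c => f (c + 1)).sum = ∑ c ∈ Finset.range n, f (c + 1) :=
    rfl
  have h0 : (f 0 : ℝ) = -∑ c ∈ Finset.range n, (f (c + 1) : ℝ) := by
    rw [hrange] at hsum
    have : f 0 = -∑ c ∈ Finset.range n, f (c + 1) := by linarith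
    exact_mod_cast this
  rw [Finset.sum_range_succ', h0, neg_smul, ← sub_eq_add_neg, Finset.sum_smul,
    ← Finset.sum_sub_distrib]
  refine .sum fun c hc => ?_
  have h1 := (isSumOfHermitianSquares_symmSum_one_sub
    (G := autPreserving (steinbergSymmGenSet 3)) (wordEval (classWords.getD (c + 1) []))).smul
    (r := -(f (c + 1) : ℝ)) (by
      have := hle c (Finset.mem_range.1 hc)
      have : (f (c + 1) : ℝ) ≤ 0 := by exact_mod_cast this
      linarith)
  convert h1 using 1
  simp only [classSum]
  rw [show classWords.getD 0 [] = [] from rfl, wordEval_nil]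
  module

theorem isSumOfHermitianSquares_symmSum_star_mul_eigenProj {χ : ℤ × ℤ × ℤ} (h₁ : χ.1 * χ.1 = 1)
    (h₂ : χ.2.1 * χ.2.1 = 1) (h₃ : χ.2.2 * χ.2.2 = 1)
    (a : MonoidAlgebra ℝ (SteinbergGroup 3)) :
    IsSumOfHermitianSquares (symmSum (autPreserving (steinbergSymmGenSet 3))
      (groupRingStar a * eigenProj χ a)) :=
  isSumOfHermitianSquares_symmSum_star_mul_twist h₁ h₂ h₃ (SteinbergSymm.aut_mem _)
    (SteinbergSymm.aut_mem _) (SteinbergSymm.aut_mem _) (signFlip_aut_mul_self 0)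
    (signFlip_aut_mul_self 1) transposeInv_aut_mul_self (signFlip_aut_comm 0 1)
    (signFlip_transposeInv_aut_comm 0) (signFlip_transposeInv_aut_comm 1) a

end Certificate

/-! ### Verification of the certificate -/

section KernelChecks

set_option maxRecDepth 100000

theorem length_certificateTerms : certificateTerms.length ≤ classHints.length := by
  decide +kernel

theorem checkClass_certificateTerms :
    (certificateTerms.zip classHints).all checkClass = true := by
  decide +kernel

theorem checkCoeffs_certificateTerms :
    checkCoeffs 53 (fun c => classCoeff c (certificateTerms.zip classHints)) = true := by
  decide +kernel

theorem certificateBlocks_signs : ∀ p ∈ certificateBlocks,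
    p.1.1 * p.1.1 = 1 ∧ p.1.2.1 * p.1.2.1 = 1 ∧ p.1.2.2 * p.1.2.2 = 1 := by
  decide +kernel

end KernelChecks

/-! ### Property (T) for `St_3(ℤ)` -/

section Main

theorem isSumOfHermitianSquares_steinberg :
    IsSumOfHermitianSquares (groupLaplacian (steinbergSymmGenSet 3) ^ 2 -
      (22 / 125 : ℝ) • groupLaplacian (steinbergSymmGenSet 3)) := by
  have := finite_autPreserving closure_steinbergSymmGenSet
  have := Fintype.ofFinite (autPreserving (steinbergSymmGenSet 3))
  set Δ := groupLaplacian (steinbergSymmGenSet 3) with hΔ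
  have hstar : groupRingStar Δ = Δ := groupRingStar_laplacian inv_mem_steinbergSymmGenSet
  -- `Δ² - ε Δ` is invariant, so it is enough to treat its symmetrization
  refine .of_symmSum (G := autPreserving (steinbergSymmGenSet 3)) (fun α hα => ?_) ?_ ?_
  · rw [map_sub, map_pow, map_smul, groupRingAut_laplacian hα]
  · rw [sub_eq_add_neg, ← neg_smul, groupRingStar_add, groupRingStar_smul, pow_two,
      groupRingStar_mul, hstar]
  -- the rounding residual has nonpositive class coefficients, hence is itself a sum of squares
  have hmap : (certificateTerms.zip classHints).map Prod.fst = certificateTerms :=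
    List.map_fst_zip length_certificateTerms
  have hclass := symmSum_evalTerms_of_checkClass checkClass_certificateTerms
  have hres := isSumOfHermitianSquares_of_checkCoeffs checkCoeffs_certificateTerms
  rw [← hclass, hmap] at hres
  -- the quadratic part of the certificate
  have hquad : IsSumOfHermitianSquares (symmSum (autPreserving (steinbergSymmGenSet 3))
      (evalTerms (quadraticTerms certificateBlocks))) := by
    rw [evalTerms_quadraticTerms, map_list_sum, List.map_map]
    refine .list_sum fun a ha => ?_
    obtain ⟨p, hp, rfl⟩ := List.mem_map.1 ha
    rw [Function.comp_apply, map_list_sum, List.map_map]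
    refine .list_sum fun a ha => ?_
    obtain ⟨r, -, rfl⟩ := List.mem_map.1 ha
    obtain ⟨h₁, h₂, h₃⟩ := certificateBlocks_signs p hp
    exact isSumOfHermitianSquares_symmSum_star_mul_eigenProj h₁ h₂ h₃ _
  have h := (hres.add hquad).smul (r := 1 / 1600000000) (by norm_num)
  rw [certificateTerms, evalTerms_append, evalTerms_append, evalTerms_scale, evalTerms_scale,
    evalTerms_scale, evalTerms_mul, evalTerms_laplacianTerms, ← map_add, ← map_smul] at h
  convert h using 2
  rw [pow_two, ← hΔ]
  push_cast
  module

theorem mainTheorem2 :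
    (∃ ε : ℝ, 0 < ε ∧
      IsSumOfHermitianSquares
        (groupLaplacian (steinbergSymmGenSet 3) ^ 2 - ε • groupLaplacian (steinbergSymmGenSet 3)) ∧
      (0.171028 : ℝ) ≤ Real.sqrt (2 * ε / ((steinbergSymmGenSet 3).card : ℝ)) ∧
      ENNReal.ofReal (Real.sqrt (2 * ε / ((steinbergSymmGenSet 3).card : ℝ))) ≤
        kazhdanConstant.{u} (steinbergSymmGenSet 3)) ∧
    ENNReal.ofReal 0.171028 ≤ kazhdanConstant.{u} (steinbergGenSet 3) ∧
    IsKazhdanGroup.{u} (SteinbergGroup 3) := by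
  have hsqrt : (0.171028 : ℝ) ≤
      Real.sqrt (2 * (22 / 125) / ((steinbergSymmGenSet 3).card : ℝ)) := by
    rw [card_steinbergSymmGenSet]
    exact Real.le_sqrt_of_sq_le (by norm_num)
  have hκ := le_kazhdanConstant_of_isSumOfHermitianSquares.{u} inv_mem_steinbergSymmGenSet
    (Finset.card_pos.1 (card_steinbergSymmGenSet ▸ by norm_num)) closure_steinbergSymmGenSet
    isSumOfHermitianSquares_steinberg
  have hκ' := (ENNReal.ofReal_le_ofReal hsqrt).trans hκ
  have hgen : kazhdanConstant.{u} (steinbergSymmGenSet 3) ≤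
      kazhdanConstant.{u} (steinbergGenSet 3) := by
    refine kazhdanConstant_le_of_mem_or_inv_mem fun s hs => ?_
    classical
    rcases Finset.mem_union.1 hs with h | h
    · exact Or.inl h
    · obtain ⟨t, ht, rfl⟩ := Finset.mem_image.1 h
      exact Or.inr (by rwa [inv_inv])
  refine ⟨⟨22 / 125, by norm_num, isSumOfHermitianSquares_steinberg, hsqrt, hκ⟩,
    hκ'.trans hgen, steinbergSymmGenSet 3, closure_steinbergSymmGenSet, ?_⟩
  exact lt_of_lt_of_le (ENNReal.ofReal_pos.2 (by norm_num)) hκ'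

end Main
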